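/- **Setting.** Let $E$ be a finite-dimensional real inner product space with norm $\|\cdot\|$ (for instance $\mathbb R^d$ with the $\ell_2$ norm), $\mathcal D\subseteq E$ a nonempty closed convex set with Euclidean projection $\Pi_{\mathcal D}$, and $L,\lambda>0$. Let $F$ be differentiable on $\mathcal D$ with $\|\nabla F(w)-\nabla F(w')\|\le L\|w-w'\|$ for all $w,w'\in\mathcal D$, and $\lambda$-strongly convex on $\mathcal D$, i.e. $F(aw+bw')\le aF(w)+bF(w')-\frac{\lambda}{2}ab\|w-w'\|^2$ for $w,w'\in\mathcal D$, $a,b\ge 0$, $a+b=1$. Let $w_*$ be the minimizer of $F$ over $\mathcal D$. A stochastic gradient oracle answers its $i$-th call, made at $w$, by a random vector $\hat g(w,i)$. The answers are independent over the calls (call number $i$ uses a random seed $\xi_i$, and the $\xi_i$ are independent), and for all $w\in\mathcal D$ and all $i$: $\mathrm E[\hat g(w,i)]=\nabla F(w)$ and $\|\hat g(w,i)\|\le G$ almost surely. **Algorithm** with parameters $\eta>0$, positive integers $M,B^1$, and a budget $T$. Start from any $w_1^1\in\mathcal D$ and $k=1$. While $2M\sum_{i=1}^k B^i\le T$: for $t=1,\dots,M$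 let $\bar g_t^k$ be the average of $B^k$ fresh oracle answers at $w_t^k$, put $z_t^k=\Pi_{\mathcal D}(w_t^k-\eta\bar g_t^k)$, let $\bar f_t^k$ be the average of $B^k$ fresh oracle answers at $z_t^k$, and put $w_{t+1}^k=\Pi_{\mathcal D}(w_t^k-\eta\bar f_t^k)$; then put $w_1^{k+1}=\frac1M\sum_{t=1}^M z_t^k$, $B^{k+1}=2B^k$, and increase $k$ by one. Return $w_1^k$. **Parameters.** $\eta=\frac1{\sqrt6L}$, $M=\frac4{\eta\lambda}$, $B^1=\alpha\eta\lambda$, where $M$ and $B^1$ are assumed to be integers. For $0<\delta<1$ and $\alpha>0$ let $$k^\dagger=\Big\lfloor\log_2\Big(\frac{T}{8\alpha}+1\Big)\Big\rfloor,\qquad \tilde\delta=\frac{\delta}{k^\dagger},\qquad N=\Big\lceil\log_2\frac{4MT}{\eta\lambda}\Big\rceil,$$ $$A(\alpha)=\max\Big\{400\log^2\frac{8M}{\tilde\delta},\ 1+64\log^2\frac{8M}{\tilde\delta}\Big(\log\frac{4N}{\tilde\delta}+\frac49\log^2\frac{4N}{\tilde\delta}\Big)\Big\}.$$ Call $\alpha$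 *admissible* for $(T,\delta)$ if $k^\dagger\ge1$ and $\alpha\ge A(\alpha)$; in particular every solution of $\alpha=A(\alpha)$ with $k^\dagger\ge 1$ is admissible. Put $X=\log\log T+\log\frac1\delta$. **Theorem.** For all $L,\lambda>0$ such that $M=4/(\eta\lambda)$ is an integer there is a constant $C>0$, depending only on $L$ and $\lambda$, such that the following hold. 1. If $\alpha$ is admissible for $(T,\delta)$, then $k^\dagger\le C\log T$, $\frac{8\sqrt6L}{\lambda}k^\dagger\le C\log T$, $N\le C\log T$ and $A(\alpha)\le C X^4$. In particular, if $\alpha=A(\alpha)$, then $\alpha=O((\log\log T+\log\frac1\delta)^4)$. 2. For all $T\ge3$ and $0<\delta<1$ with $CX^4\le T$ there is an admissible $\alpha\le CX^4$ for which $B^1=\alpha\eta\lambda$ is an integer. 3. For every problem and oracle as above, every $T$ and $0<\delta<1$, every admissible $\alpha$ such that $B^1=\alpha\eta\lambda$ is an integer, and every starting point in $\mathcal D$, the algorithm makes at most $T$ oracle calls and performs exactly $$\frac{8\sqrt6L}{\lambda}\Big\lfloor\log_2\Big(\frac{T}{8\alpha}+1\Big)\Big\rfloor=O(\log T)$$ projections,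 and with probability at least $1-\delta$ the returned point $\hat w$ satisfies $$F(\hat w)-F(w_*)\le\frac{32\,\alpha\,G^2}{\lambda T}.$$ If moreover $\alpha\le CX^4$ (for instance if $\alpha=A(\alpha)$), then with probability at least $1-\delta$ $$F(\hat w)-F(w_*)\le\frac{32\,C\,G^2}{\lambda}\cdot\frac{(\log\log T+\log\frac1\delta)^4}{T}.$$ -/

import Mathlib

open MeasureTheory ProbabilityTheory

/-- The Euclidean projection onto `D`: a point of `D` nearest to `x`. For a nonempty closed convex
`D` in a complete space it exists and is unique (the value `x` is used only if there is none). -/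
noncomputable def euclideanProj {E : Type*} [NormedAddCommGroup E] (D : Set E) (x : E) : E :=
  open Classical in
  if h : ∃ p, p ∈ D ∧ ∀ q ∈ D, ‖x - p‖ ≤ ‖x - q‖ then h.choose else x

/-- State between two epochs: the current point, the number of oracle calls made so far and the
number of projections performed so far. -/
structure RunState (E : Type*) where
  point : E
  calls : ℕ
  projections : ℕ

/-- State inside an epoch: the current `w_t`, the sum `z_1 + ⋯ + z_{t-1}`, and the two counters. -/
structure InnerState (E : Type*) where
  w : E
  zsum : E
  calls : ℕ
  projections : ℕ

section Algorithm

variable {E : Type*} [NormedAddCommGroup E] [InnerProductSpace ℝ E]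

/-- Average of the answers of `B` consecutive oracle calls at the point `w`, when `c` calls have been
made before. Here `g j x` is the answer of call number `j` (counted from `0`) if it is made at `x`. -/
noncomputable def batchMean (g : ℕ → E → E) (c B : ℕ) (w : E) : E :=
  (B : ℝ)⁻¹ • ∑ i ∈ Finset.range B, g (c + i) w

/-- One iteration of the inner loop (extra-gradient step with mini-batches of size `B`). -/
noncomputable def innerStep (D : Set E) (η : ℝ) (g : ℕ → E → E) (B : ℕ) (s : InnerState E) :
    InnerState E :=
  let z := euclideanProj D (s.w - η • batchMean g s.calls B s.w)
  { w := euclideanProj D (s.w - η • batchMean g (s.calls + B) B z)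
    zsum := s.zsum + z
    calls := s.calls + B + B
    projections := s.projections + 2 }

/-- One epoch: `M` inner iterations with batch size `B`; the next point is the average of the `z_t`. -/
noncomputable def runEpoch (D : Set E) (η : ℝ) (M : ℕ) (g : ℕ → E → E) (B : ℕ) (s : RunState E) :
    RunState E :=
  let r := (innerStep D η g B)^[M]
    { w := s.point, zsum := 0, calls := s.calls, projections := s.projections }
  { point := (M : ℝ)⁻¹ • r.zsum
    calls := r.calls
    projections := r.projections }

/-- Batch size of epoch number `n + 1`: the initial size `B₁`, doubled after every epoch. -/
def batchSize (B₁ : ℕ) : ℕ → ℕ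
  | 0 => B₁
  | n + 1 => 2 * batchSize B₁ n

/-- State after `n` epochs, started at `w₁`. -/
noncomputable def stateAfter (D : Set E) (η : ℝ) (M B₁ : ℕ) (w₁ : E) (g : ℕ → E → E) :
    ℕ → RunState E
  | 0 => { point := w₁, calls := 0, projections := 0 }
  | n + 1 => runEpoch D η M g (batchSize B₁ n) (stateAfter D η M B₁ w₁ g n)

/-- Number of passes of the loop `while 2 * M * (B^1 + ⋯ + B^k) ≤ T` (with `k = 1` at the start and
`k` increased by one in every pass): the least `n` such that the test made after `n` passes, with
`k = n + 1`, fails. -/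
noncomputable def numPasses (M B₁ T : ℕ) : ℕ :=
  sInf {n : ℕ | ¬ 2 * M * ∑ i ∈ Finset.range (n + 1), batchSize B₁ i ≤ T}

/-- The final state of the algorithm with step size `η`, `M` updates per epoch, initial batch size
`B₁`, budget `T` of oracle calls, initial point `w₁` and oracle answers `g`. -/
noncomputable def runAlgorithm (D : Set E) (η : ℝ) (M B₁ T : ℕ) (w₁ : E) (g : ℕ → E → E) :
    RunState E :=
  stateAfter D η M B₁ w₁ g (numPasses M B₁ T)

end Algorithm

/-- The step size `η = 1 / (√6 L)`. -/
noncomputable def stepSize (L : ℝ) : ℝ := 1 / (√6 * L)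

/-- `k† = ⌊log₂ (T / (8 α) + 1)⌋`. -/
noncomputable def kDagger (T : ℕ) (α : ℝ) : ℕ := ⌊Real.logb 2 ((T : ℝ) / (8 * α) + 1)⌋₊

/-- `δ̃ = δ / k†`. -/
noncomputable def deltaTilde (T : ℕ) (δ α : ℝ) : ℝ := δ / (kDagger T α : ℝ)

/-- `N = ⌈log₂ (4 M T / (η lam))⌉`. -/
noncomputable def shellCount (L lam : ℝ) (M T : ℕ) : ℕ :=
  ⌈Real.logb 2 (4 * (M : ℝ) * (T : ℝ) / (stepSize L * lam))⌉₊

/-- The expression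
`max {400 log² (8M/δ̃), 1 + 64 log² (8M/δ̃) (log (4N/δ̃) + 4/9 log² (4N/δ̃))}`,
which depends on `α` through `δ̃ = δ / k†`. -/
noncomputable def alphaExpr (L lam : ℝ) (M T : ℕ) (δ α : ℝ) : ℝ :=
  max (400 * Real.log (8 * (M : ℝ) / deltaTilde T δ α) ^ 2)
    (1 + 64 * Real.log (8 * (M : ℝ) / deltaTilde T δ α) ^ 2 *
      (Real.log (4 * (shellCount L lam M T : ℝ) / deltaTilde T δ α) +
        4 / 9 * Real.log (4 * (shellCount L lam M T : ℝ) / deltaTilde T δ α) ^ 2))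

/-- `log log T + log (1/δ)`. -/
noncomputable def logFactor (T : ℕ) (δ : ℝ) : ℝ := Real.log (Real.log (T : ℝ)) + Real.log (1 / δ)

/-! ### Euclidean projection and the extra-gradient inequality. -/

section Projection

variable {E : Type*} [NormedAddCommGroup E] [InnerProductSpace ℝ E] [CompleteSpace E] {D : Set E}

/-! The error bound is `2 * G ^ 2 / (lam * 2 ^ n)` after `n` epochs, and each epoch halves it with
failure probability at most `δ̃`. A union bound over the `k†` epochs, together with `2 ^ (k† + 1) >
T / (8 α) + 1`, gives the rate.

Inside an epoch, the extra-gradient inequality is telescoped. The Lipschitz part of the difference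
between the two batch gradients is absorbed by a negative square, so only the squared noise of the
batches remains (`runEpoch_sub_le`). Since `M η lam = 4`, the initial distance contributes a quarter
of the current error bound, by quadratic growth at the minimizer. All noise terms are of order `l /
α` times the bound, where `l = log (8M/δ̃)`, and are small once `α ≥ 400 l`.

Two concentration facts control the noise. The norm of a batch mean has a dimension-free
sub-Gaussian tail, because the expected `cosh` of the norm of a sum grows by a factor of at most
`exp (b ^ 2)` per centred summand (`measure_norm_batch_gt_le`). The inner products of the noise with
`z_t - u` have variance proportional to `‖z_t - u‖ ^ 2`, and the quadratic term of strong convexity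
cancels exactly this. They therefore form an exponential supermartingale with no a priori bound on
the distances (`lintegral_exp_epoch_le`).

The orders of magnitude follow because `k†` and `N` are `O(log T)`, so the logarithms in `alphaExpr`
are at most constant multiples of `X ≥ log log 3 > 0`. -/

theorem euclideanProj_spec (hne : D.Nonempty) (hcl : IsClosed D) (hco : Convex ℝ D) (x : E) :
    euclideanProj D x ∈ D ∧ ∀ q ∈ D, ‖x - euclideanProj D x‖ ≤ ‖x - q‖ := by
  have h : ∃ p, p ∈ D ∧ ∀ q ∈ D, ‖x - p‖ ≤ ‖x - q‖ := by
    obtain ⟨v, hv, hveq⟩ := exists_norm_eq_iInf_of_complete_convex hne hcl.isComplete hco x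
    refine ⟨v, hv, fun q hq => ?_⟩
    rw [hveq]
    exact ciInf_le ⟨0, by rintro _ ⟨y, rfl⟩; positivity⟩ (⟨q, hq⟩ : D)
  have : euclideanProj D x = h.choose := by
    unfold euclideanProj
    exact dif_pos h
  rw [this]
  exact h.choose_spec

theorem euclideanProj_mem (hne : D.Nonempty) (hcl : IsClosed D) (hco : Convex ℝ D) (x : E) :
    euclideanProj D x ∈ D :=
  (euclideanProj_spec hne hcl hco x).1

theorem inner_sub_euclideanProj_nonpos (hcl : IsClosed D) (hco : Convex ℝ D) (x : E) {q : E}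
    (hq : q ∈ D) : inner ℝ (x - euclideanProj D x) (q - euclideanProj D x) ≤ 0 := by
  obtain ⟨hp, hmin⟩ := euclideanProj_spec ⟨q, hq⟩ hcl hco x
  have : Nonempty D := ⟨⟨q, hq⟩⟩
  refine (norm_eq_iInf_iff_real_inner_le_zero hco hp).1 (le_antisymm ?_ ?_) q hq
  · exact le_ciInf fun y => hmin y y.2
  · exact ciInf_le ⟨0, by rintro _ ⟨y, rfl⟩; positivity⟩ (⟨_, hp⟩ : D)

theorem euclideanProj_of_mem (hcl : IsClosed D) (hco : Convex ℝ D) {x : E} (hx : x ∈ D) :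
    euclideanProj D x = x := by
  have h := (euclideanProj_spec ⟨x, hx⟩ hcl hco x).2 x hx
  rw [sub_self, norm_zero] at h
  exact (sub_eq_zero.1 (norm_le_zero_iff.1 h)).symm

theorem norm_euclideanProj_sub_le (hne : D.Nonempty) (hcl : IsClosed D) (hco : Convex ℝ D)
    (x y : E) : ‖euclideanProj D x - euclideanProj D y‖ ≤ ‖x - y‖ := by
  set p := euclideanProj D x with hp
  set q := euclideanProj D y with hq
  have h1 := inner_sub_euclideanProj_nonpos hcl hco x (euclideanProj_mem hne hcl hco y)
  have h2 := inner_sub_euclideanProj_nonpos hcl hco y (euclideanProj_mem hne hcl hco x)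
  rw [← hp, ← hq] at h1 h2
  have h3 : ‖p - q‖ ^ 2 = inner ℝ (x - p) (q - p) + inner ℝ (y - q) (p - q)
      + inner ℝ (x - y) (p - q) := by
    rw [← real_inner_self_eq_norm_sq, ← neg_sub p q, inner_neg_right, ← inner_neg_left,
      ← inner_add_left, ← inner_add_left]
    congr 1
    abel
  have h4 := real_inner_le_norm (x - y) (p - q)
  by_contra! h
  have : 0 < ‖p - q‖ := (norm_nonneg _).trans_lt h
  nlinarith

/-- Continuity makes the iterates measurable functions of the seeds. -/
theorem continuous_euclideanProj (hne : D.Nonempty) (hcl : IsClosed D) (hco : Convex ℝ D) :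
    Continuous (euclideanProj D) :=
  (LipschitzWith.of_dist_le_mul (K := 1) fun x y => by
    simpa [dist_eq_norm] using norm_euclideanProj_sub_le hne hcl hco x y).continuous

/-- The proximal inequality of a projected gradient step. -/
theorem inner_euclideanProj_step_le (hcl : IsClosed D) (hco : Convex ℝ D) (w v : E) {u : E}
    (hu : u ∈ D) :
    inner ℝ v (euclideanProj D (w - v) - u) ≤
      (‖w - u‖ ^ 2 - ‖euclideanProj D (w - v) - u‖ ^ 2 - ‖w - euclideanProj D (w - v)‖ ^ 2) / 2 := by
  have h := inner_sub_euclideanProj_nonpos hcl hco (w - v) hu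
  set p := euclideanProj D (w - v)
  have h1 : w - u = (w - p) + (p - u) := by abel
  have h2 : inner ℝ (w - v - p) (u - p) = inner ℝ v (p - u) - inner ℝ (w - p) (p - u) := by
    rw [← neg_sub p u, inner_neg_right, show w - v - p = (w - p) - v by abel, inner_sub_left]
    ring
  rw [h1, norm_add_sq_real]
  linarith

/-- One extra-gradient step. -/
theorem inner_extragradient_le (hcl : IsClosed D) (hco : Convex ℝ D) (η : ℝ) (hη : 0 ≤ η)
    (w a b : E) {u : E} (hu : u ∈ D) :
    η * inner ℝ b (euclideanProj D (w - η • a) - u) ≤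
      (‖w - u‖ ^ 2 - ‖euclideanProj D (w - η • b) - u‖ ^ 2) / 2 + η ^ 2 / 2 * ‖b - a‖ ^ 2
        - ‖w - euclideanProj D (w - η • a)‖ ^ 2 / 2 := by
  have h1 := inner_euclideanProj_step_le hcl hco w (η • b) hu
  have h2 := inner_euclideanProj_step_le hcl hco w (η • a)
    (euclideanProj_mem ⟨u, hu⟩ hcl hco (w - η • b))
  set z := euclideanProj D (w - η • a)
  set p := euclideanProj D (w - η • b)
  rw [inner_smul_left] at h1 h2
  simp only [RCLike.conj_to_real] at h1 h2
  -- The first two terms are handled by the proximal inequalities at `u` and at `p`, whose `‖w - p‖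
  -- ^ 2` cancel. The last is paid for by `-‖z - p‖ ^ 2 / 2` through Young's inequality.
  have h3 : inner ℝ b (z - u) = inner ℝ b (p - u) + inner ℝ a (z - p) + inner ℝ (b - a) (z - p) := by
    rw [add_assoc, ← inner_add_left, show z - u = (p - u) + (z - p) by abel, inner_add_right]
    congr 2
    abel
  have h4 := real_inner_le_norm (b - a) (z - p)
  have h5 := mul_le_mul_of_nonneg_left h4 hη
  rw [h3]
  nlinarith [sq_nonneg (η * ‖b - a‖ - ‖z - p‖)]

end Projection

/-! ### First-order consequences of strong convexity on a closed domain. -/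

section StrongConvexity

variable {E : Type*} [NormedAddCommGroup E] [InnerProductSpace ℝ E] [CompleteSpace E] {D : Set E}
  {F : E → ℝ} {lam : ℝ}

/-- Along the segment from `w` to `u`, the strong convexity bound minus `F` is nonnegative and
vanishes at `w`, so its one-sided derivative there is nonnegative. Staying on the segment is needed
because the gradient is taken within `D`. -/
theorem StrongConvexOn.sub_le_inner_sub {v w u : E} (hF : StrongConvexOn D lam F) (hw : w ∈ D)
    (hu : u ∈ D) (hv : HasGradientWithinAt F v D w) :
    F w - F u ≤ inner ℝ v (w - u) - lam / 2 * ‖w - u‖ ^ 2 := by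
  let q : ℝ → E := fun b => w + b • (u - w)
  have hq : HasDerivWithinAt q (u - w) (Set.Icc 0 1) 0 := by
    have := ((hasDerivAt_id (0 : ℝ)).smul_const (u - w)).const_add w
    simpa [q] using this.hasDerivWithinAt
  have hmaps : Set.MapsTo q (Set.Icc 0 1) D := fun b hb =>
    hF.1.add_smul_sub_mem hw hu hb
  have hv' : HasFDerivWithinAt F (InnerProductSpace.toDual ℝ E v) D (q 0) := by
    have := hasGradientWithinAt_iff_hasFDerivWithinAt.1 hv
    simpa [q] using this
  have hφ := hv'.comp_hasDerivWithinAt (0 : ℝ) hq hmaps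
  have hψ : HasDerivWithinAt (fun b : ℝ => (F w + b * (F u - F w)
      - b * (1 - b) * (lam / 2 * ‖w - u‖ ^ 2)) - (F ∘ q) b)
      ((F u - F w - lam / 2 * ‖w - u‖ ^ 2) - inner ℝ v (u - w)) (Set.Icc 0 1) 0 := by
    refine HasDerivWithinAt.sub ?_ (by simpa using hφ)
    have h1 := ((hasDerivAt_id (0 : ℝ)).mul_const (F u - F w)).const_add (F w)
    have h2 := (((hasDerivAt_id (0 : ℝ)).mul ((hasDerivAt_id (0 : ℝ)).const_sub 1))).mul_const
      (lam / 2 * ‖w - u‖ ^ 2)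
    exact ((h1.sub h2).congr_deriv (by simp)).hasDerivWithinAt
  have hmin : IsMinOn (fun b : ℝ => (F w + b * (F u - F w)
      - b * (1 - b) * (lam / 2 * ‖w - u‖ ^ 2)) - (F ∘ q) b) (Set.Icc 0 1) 0 := by
    intro b hb
    have h := hF.2 hw hu (sub_nonneg.2 hb.2) hb.1 (by ring)
    have e : q b = (1 - b) • w + b • u := by
      simp only [q, smul_sub, sub_smul, one_smul]; abel
    simp only [Set.mem_ofPred_eq, Function.comp, e]
    simp only [smul_eq_mul] at h
    simp [q]
    linarith
  have := hmin.localize.hasFDerivWithinAt_nonneg hψ.hasFDerivWithinAt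
    (mem_posTangentConeAt_of_segment_subset (y := 1) (by simp [segment_eq_Icc]))
  have h3 : inner ℝ v (u - w) = - inner ℝ v (w - u) := by rw [← inner_neg_right, neg_sub]
  simp at this
  linarith

/-- Quadratic growth: in the first-order inequality at the minimizer, the linear term has a sign by
optimality. -/
theorem StrongConvexOn.sq_norm_sub_le_of_isMinOn {v w u : E} (hF : StrongConvexOn D lam F)
    (hw : w ∈ D) (hu : u ∈ D) (hv : HasGradientWithinAt F v D u) (hmin : IsMinOn F D u) :
    lam / 2 * ‖w - u‖ ^ 2 ≤ F w - F u := by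
  have h1 := hF.sub_le_inner_sub hu hw hv
  have h2 := hmin.localize.hasFDerivWithinAt_nonneg
    (hasGradientWithinAt_iff_hasFDerivWithinAt.1 hv) (y := w - u)
    (mem_posTangentConeAt_of_segment_subset (by simpa using hF.1.segment_subset hu hw))
  simp only [InnerProductSpace.toDual_apply_apply] at h2
  have h3 : inner ℝ v (u - w) = - inner ℝ v (w - u) := by rw [← inner_neg_right, neg_sub]
  rw [norm_sub_rev] at h1
  linarith

/-- Maximizes `G r - lam / 2 * r ^ 2` over `r`. This bounds the error of an arbitrary starting
point. -/
theorem StrongConvexOn.sub_le_of_norm_gradient_le {v w u : E} {G : ℝ} (hlam : 0 < lam)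
    (hF : StrongConvexOn D lam F) (hw : w ∈ D) (hu : u ∈ D) (hv : HasGradientWithinAt F v D w)
    (hG : ‖v‖ ≤ G) : F w - F u ≤ G ^ 2 / (2 * lam) := by
  have h1 := hF.sub_le_inner_sub hw hu hv
  have h2 := (real_inner_le_norm v (w - u)).trans
    (mul_le_mul_of_nonneg_right hG (norm_nonneg (w - u)))
  rw [le_div_iff₀ (by positivity)]
  nlinarith [sq_nonneg (G - lam * ‖w - u‖)]

end StrongConvexity

/-! ### Deterministic analysis of one epoch. -/

section Epoch

variable {E : Type*} [NormedAddCommGroup E] [InnerProductSpace ℝ E]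

/-- The extrapolated point `z_t` of an inner iteration. -/
noncomputable def extraPoint (D : Set E) (η : ℝ) (g : ℕ → E → E) (B : ℕ) (s : InnerState E) : E :=
  euclideanProj D (s.w - η • batchMean g s.calls B s.w)

/-- The state at the start of an epoch. -/
def RunState.toInner (s : RunState E) : InnerState E :=
  { w := s.point, zsum := 0, calls := s.calls, projections := s.projections }

theorem iterate_innerStep_calls (D : Set E) (η : ℝ) (g : ℕ → E → E) (B : ℕ) (s : InnerState E)
    (t : ℕ) : ((innerStep D η g B)^[t] s).calls = s.calls + 2 * B * t := by
  induction t with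
  | zero => simp
  | succ t ih => rw [Function.iterate_succ_apply']; simp only [innerStep, ih]; ring

theorem iterate_innerStep_projections (D : Set E) (η : ℝ) (g : ℕ → E → E) (B : ℕ)
    (s : InnerState E) (t : ℕ) :
    ((innerStep D η g B)^[t] s).projections = s.projections + 2 * t := by
  induction t with
  | zero => simp
  | succ t ih => rw [Function.iterate_succ_apply']; simp only [innerStep, ih]; ring

theorem iterate_innerStep_zsum (D : Set E) (η : ℝ) (g : ℕ → E → E) (B : ℕ) (s : InnerState E)
    (t : ℕ) : ((innerStep D η g B)^[t] s).zsum =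
      s.zsum + ∑ i ∈ Finset.range t, extraPoint D η g B ((innerStep D η g B)^[i] s) := by
  induction t with
  | zero => simp
  | succ t ih =>
    rw [Function.iterate_succ_apply', Finset.sum_range_succ, ← add_assoc, ← ih]
    rfl

theorem runEpoch_calls (D : Set E) (η : ℝ) (M : ℕ) (g : ℕ → E → E) (B : ℕ) (s : RunState E) :
    (runEpoch D η M g B s).calls = s.calls + 2 * B * M :=
  iterate_innerStep_calls D η g B _ M

theorem runEpoch_projections (D : Set E) (η : ℝ) (M : ℕ) (g : ℕ → E → E) (B : ℕ)
    (s : RunState E) : (runEpoch D η M g B s).projections = s.projections + 2 * M :=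
  iterate_innerStep_projections D η g B _ M

theorem runEpoch_point (D : Set E) (η : ℝ) (M : ℕ) (g : ℕ → E → E) (B : ℕ) (s : RunState E) :
    (runEpoch D η M g B s).point = (M : ℝ)⁻¹ •
      ∑ i ∈ Finset.range M, extraPoint D η g B ((innerStep D η g B)^[i] s.toInner) := by
  have := iterate_innerStep_zsum D η g B s.toInner M
  rw [show s.toInner.zsum = 0 from rfl, zero_add] at this
  rw [← this]
  rfl

variable [CompleteSpace E] {D : Set E}

theorem extraPoint_mem (hne : D.Nonempty) (hcl : IsClosed D) (hco : Convex ℝ D) (η : ℝ)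
    (g : ℕ → E → E) (B : ℕ) (s : InnerState E) : extraPoint D η g B s ∈ D :=
  euclideanProj_mem hne hcl hco _

theorem iterate_innerStep_mem (hcl : IsClosed D) (hco : Convex ℝ D) (η : ℝ) (g : ℕ → E → E)
    (B : ℕ) {s : InnerState E} (hs : s.w ∈ D) (t : ℕ) : ((innerStep D η g B)^[t] s).w ∈ D := by
  cases t with
  | zero => exact hs
  | succ t => rw [Function.iterate_succ_apply']; exact euclideanProj_mem ⟨_, hs⟩ hcl hco _

theorem runEpoch_mem (hne : D.Nonempty) (hcl : IsClosed D) (hco : Convex ℝ D) (η : ℝ) {M : ℕ}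
    (hM : 0 < M) (g : ℕ → E → E) (B : ℕ) (s : RunState E) :
    (runEpoch D η M g B s).point ∈ D := by
  rw [runEpoch_point, Finset.smul_sum]
  refine hco.sum_mem (fun _ _ => by positivity) ?_ fun i _ => extraPoint_mem hne hcl hco η g B _
  simp [hM.ne']

theorem stateAfter_mem (hcl : IsClosed D) (hco : Convex ℝ D) (η : ℝ) {M : ℕ} (hM : 0 < M)
    (B₁ : ℕ) {w₁ : E} (hw₁ : w₁ ∈ D) (g : ℕ → E → E) (n : ℕ) :
    (stateAfter D η M B₁ w₁ g n).point ∈ D := by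
  cases n with
  | zero => exact hw₁
  | succ n => exact runEpoch_mem ⟨_, hw₁⟩ hcl hco η hM g _ _

/-- One inner iteration with oracle noise of squared norm at most `ν`. -/
theorem inner_batchMean_extraPoint_le (hcl : IsClosed D) (hco : Convex ℝ D) {η L ν : ℝ}
    (hη : 0 < η) (hηL : 3 * η ^ 2 * L ^ 2 ≤ 1) {gradF : E → E}
    (hLip : ∀ w ∈ D, ∀ w' ∈ D, ‖gradF w - gradF w'‖ ≤ L * ‖w - w'‖) (g : ℕ → E → E) (B : ℕ)
    (s : InnerState E) (hs : s.w ∈ D) {u : E} (hu : u ∈ D)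
    (hg : ‖batchMean g s.calls B s.w - gradF s.w‖ ^ 2 ≤ ν)
    (hf : ‖batchMean g (s.calls + B) B (extraPoint D η g B s)
      - gradF (extraPoint D η g B s)‖ ^ 2 ≤ ν) :
    η * inner ℝ (batchMean g (s.calls + B) B (extraPoint D η g B s)) (extraPoint D η g B s - u) ≤
      (‖s.w - u‖ ^ 2 - ‖(innerStep D η g B s).w - u‖ ^ 2) / 2 + 3 * η ^ 2 * ν := by
  have hz := extraPoint_mem ⟨u, hu⟩ hcl hco η g B s
  have key := inner_extragradient_le hcl hco η hη.le s.w (batchMean g s.calls B s.w)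
    (batchMean g (s.calls + B) B (extraPoint D η g B s)) hu
  change _ ≤ (‖s.w - u‖ ^ 2 - ‖(innerStep D η g B s).w - u‖ ^ 2) / 2 + _ - _ at key
  change η * inner ℝ _ (extraPoint D η g B s - u) ≤ _ + _ - ‖s.w - extraPoint D η g B s‖ ^ 2 / 2
    at key
  set z := extraPoint D η g B s
  set a := batchMean g s.calls B s.w
  set b := batchMean g (s.calls + B) B z
  have h1 := hLip z hz s.w hs
  rw [norm_sub_rev z] at h1
  have h2 : ‖b - a‖ ≤ ‖b - gradF z‖ + ‖gradF z - gradF s.w‖ + ‖a - gradF s.w‖ := by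
    rw [show b - a = (b - gradF z) + (gradF z - gradF s.w) - (a - gradF s.w) by abel]
    exact (norm_sub_le _ _).trans (add_le_add_left (norm_add_le _ _) _)
  have h3 : ‖gradF z - gradF s.w‖ ^ 2 ≤ L ^ 2 * ‖s.w - z‖ ^ 2 := by
    rw [← mul_pow]; exact pow_le_pow_left₀ (norm_nonneg _) h1 2
  have h4 : ‖b - a‖ ^ 2 ≤ 3 * (‖b - gradF z‖ ^ 2 + ‖gradF z - gradF s.w‖ ^ 2
      + ‖a - gradF s.w‖ ^ 2) := by
    refine (pow_le_pow_left₀ (norm_nonneg _) h2 2).trans ?_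
    nlinarith [sq_nonneg (‖b - gradF z‖ - ‖gradF z - gradF s.w‖),
      sq_nonneg (‖b - gradF z‖ - ‖a - gradF s.w‖),
      sq_nonneg (‖gradF z - gradF s.w‖ - ‖a - gradF s.w‖)]
  have h5 : ‖b - a‖ ^ 2 ≤ 6 * ν + 3 * L ^ 2 * ‖s.w - z‖ ^ 2 := by linarith
  have h6 := mul_le_mul_of_nonneg_left h5 (by positivity : 0 ≤ η ^ 2 / 2)
  -- The condition on `η` lets `-‖s.w - z‖ ^ 2 / 2` absorb the Lipschitz part, leaving `η ^ 2 / 2 *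
  -- 6 ν = 3 η ^ 2 ν`.
  have h7 := mul_le_mul_of_nonneg_right hηL (by positivity : 0 ≤ ‖s.w - z‖ ^ 2)
  linarith

/-- Progress of one epoch, in terms of the noise of its batches. -/
theorem runEpoch_sub_le {F : E → ℝ} {gradF : E → E} {η L lam ν κ : ℝ} (hcl : IsClosed D)
    (hlam : 0 < lam) (hF : StrongConvexOn D lam F)
    (hgrad : ∀ w ∈ D, HasGradientWithinAt F (gradF w) D w)
    (hLip : ∀ w ∈ D, ∀ w' ∈ D, ‖gradF w - gradF w'‖ ≤ L * ‖w - w'‖)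
    (hη : 0 < η) (hηL : 3 * η ^ 2 * L ^ 2 ≤ 1) {M : ℕ} (hM : 0 < M) (g : ℕ → E → E) (B : ℕ)
    (s : RunState E) (hs : s.point ∈ D) {u : E} (hu : u ∈ D)
    (S : ℕ → InnerState E) (hS : ∀ t, S t = (innerStep D η g B)^[t] s.toInner)
    (hg : ∀ t < M, ‖batchMean g (S t).calls B (S t).w - gradF (S t).w‖ ^ 2 ≤ ν)
    (hf : ∀ t < M, ‖batchMean g ((S t).calls + B) B (extraPoint D η g B (S t))
      - gradF (extraPoint D η g B (S t))‖ ^ 2 ≤ ν)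
    (hκ : ∑ t ∈ Finset.range M,
      (inner ℝ (gradF (extraPoint D η g B (S t))
          - batchMean g ((S t).calls + B) B (extraPoint D η g B (S t)))
          (extraPoint D η g B (S t) - u)
        - lam / 2 * ‖extraPoint D η g B (S t) - u‖ ^ 2) ≤ κ) :
    F (runEpoch D η M g B s).point - F u ≤
      ‖s.point - u‖ ^ 2 / (2 * M * η) + 3 * η * ν + κ / M := by
  have hco := hF.1
  have hMr : (0 : ℝ) < M := by exact_mod_cast hM
  have hmem : ∀ t, (S t).w ∈ D := fun t => by
    rw [hS]; exact iterate_innerStep_mem hcl hco η g B hs t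
  have hz : ∀ t, extraPoint D η g B (S t) ∈ D := fun t => extraPoint_mem ⟨u, hu⟩ hcl hco η g B _
  have hconv : ConvexOn ℝ D F := UniformConvexOn.convexOn hF (fun r => by
    simp only [Pi.zero_apply]; positivity)
  have hJ : F (runEpoch D η M g B s).point ≤
      ∑ t ∈ Finset.range M, (M : ℝ)⁻¹ • F (extraPoint D η g B (S t)) := by
    rw [runEpoch_point, Finset.smul_sum]
    simp only [← hS]
    exact hconv.map_sum_le (fun _ _ => by positivity) (by simp [hM.ne']) fun t _ => hz t
  have hsum : ∀ n ≤ M, η * ∑ t ∈ Finset.range n,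
      inner ℝ (batchMean g ((S t).calls + B) B (extraPoint D η g B (S t)))
        (extraPoint D η g B (S t) - u) ≤
      (‖s.point - u‖ ^ 2 - ‖(S n).w - u‖ ^ 2) / 2 + 3 * η ^ 2 * ν * n := by
    intro n hn
    induction n with
    | zero => simp [hS, RunState.toInner]
    | succ n ih =>
      have h1 := ih (by omega)
      have h2 := inner_batchMean_extraPoint_le hcl hco hη hηL hLip g B (S n) (hmem n) hu
        (hg n (by omega)) (hf n (by omega))
      rw [show innerStep D η g B (S n) = S (n + 1) by
        rw [hS, hS, Function.iterate_succ_apply']] at h2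
      rw [Finset.sum_range_succ, mul_add]
      push_cast
      linarith
  have hM1 := hsum M le_rfl
  -- The exact gradient is replaced by the batch mean. The quadratic gain of strong convexity stays
  -- with the replacement error inside `κ`, where it later offsets the exponential moment of that
  -- error.
  have hgap : ∑ t ∈ Finset.range M, (F (extraPoint D η g B (S t)) - F u) ≤
      κ + ∑ t ∈ Finset.range M,
        inner ℝ (batchMean g ((S t).calls + B) B (extraPoint D η g B (S t)))
          (extraPoint D η g B (S t) - u) := by
    refine le_trans ?_ (add_le_add_left hκ _)
    rw [← Finset.sum_add_distrib]
    refine Finset.sum_le_sum fun t _ => ?_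
    have := hF.sub_le_inner_sub (hz t) hu (hgrad _ (hz t))
    rw [inner_sub_left]
    linarith
  rw [Finset.sum_sub_distrib, Finset.sum_const, Finset.card_range, nsmul_eq_mul] at hgap
  simp only [smul_eq_mul] at hJ
  rw [← Finset.mul_sum, inv_mul_eq_div, le_div_iff₀ hMr] at hJ
  set Q := ∑ t ∈ Finset.range M,
        inner ℝ (batchMean g ((S t).calls + B) B (extraPoint D η g B (S t)))
          (extraPoint D η g B (S t) - u)
  have hQ : Q ≤ ‖s.point - u‖ ^ 2 / (2 * η) + 3 * η * ν * M := by
    have : ‖s.point - u‖ ^ 2 / (2 * η) * η = ‖s.point - u‖ ^ 2 / 2 := by field_simp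
    refine le_of_mul_le_mul_left ?_ hη
    nlinarith [sq_nonneg ‖(S M).w - u‖]
  have e : ‖s.point - u‖ ^ 2 / (2 * M * η) + 3 * η * ν + κ / M
      = (‖s.point - u‖ ^ 2 / (2 * η) + 3 * η * ν * M + κ) / M := by
    field_simp
  rw [e, le_div_iff₀ hMr]
  linarith

end Epoch

/-! ### Scalar and vector inequalities behind the exponential moments. -/

section Elementary

/-- For a centred variable the linear term integrates to zero, which leaves a sub-Gaussian bound. -/
theorem Real.exp_le_self_add_exp_sq (t : ℝ) : Real.exp t ≤ t + Real.exp (t ^ 2) := by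
  have h2 := Real.add_one_le_exp (t ^ 2)
  rcases le_total |t| 1 with h | h
  · have h1 := (abs_le.1 (Real.abs_exp_sub_one_sub_id_le h)).2
    linarith
  · rcases le_abs.1 h with h | h
    · have : Real.exp t ≤ Real.exp (t ^ 2) := Real.exp_le_exp.2 (by nlinarith)
      linarith
    · have : Real.exp t ≤ 1 := Real.exp_le_one_iff.2 (by linarith)
      nlinarith

/-- `cosh (√y)` is a convex function of `y`, between `(r - s) ^ 2` and `(r + s) ^ 2`. -/
theorem Real.cosh_le_of_sq_eq {q r s c : ℝ} (hc : |c| ≤ 1)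
    (hq : q ^ 2 = r ^ 2 + 2 * (r * s * c) + s ^ 2) :
    Real.cosh q ≤ (1 + c) / 2 * Real.cosh (r + s) + (1 - c) / 2 * Real.cosh (r - s) := by
  have hc' := abs_le.1 hc
  -- The series of `cosh` involves only powers of the square, so convexity of `y ↦ y ^ n` on
  -- nonnegative reals applies term by term.
  refine hasSum_le (fun n => ?_) (Real.hasSum_cosh q)
    (((Real.hasSum_cosh (r + s)).mul_left _).add ((Real.hasSum_cosh (r - s)).mul_left _))
  have h := (convexOn_pow (𝕜 := ℝ) n).2 (sq_nonneg (r + s)) (sq_nonneg (r - s))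
    (show 0 ≤ (1 + c) / 2 by linarith) (show 0 ≤ (1 - c) / 2 by linarith) (by ring)
  simp only [smul_eq_mul] at h
  rw [show (1 + c) / 2 * (r + s) ^ 2 + (1 - c) / 2 * (r - s) ^ 2 = q ^ 2 by rw [hq]; ring] at h
  rw [← mul_div_assoc, ← mul_div_assoc, ← add_div, pow_mul, pow_mul, pow_mul]
  gcongr

variable {E : Type*} [NormedAddCommGroup E] [InnerProductSpace ℝ E]

/-- With `r = ‖x‖`, `s = ‖y‖` and `c` the cosine of the angle, convexity gives `cosh r cosh s + c
sinh r sinh s`. Splitting off the part of `sinh s` linear in `s` leaves the inner product, and `c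
sinh r ≤ cosh r` bounds the rest by `cosh r (exp s - s)`. -/
theorem cosh_norm_add_le {x y : E} {b : ℝ} (hy : ‖y‖ ≤ b) :
    Real.cosh ‖x + y‖ ≤
      Real.cosh ‖x‖ * Real.exp (b ^ 2) + Real.sinh ‖x‖ / ‖x‖ * inner ℝ x y := by
  set c := inner ℝ x y / (‖x‖ * ‖y‖) with hc
  have hc1 : |c| ≤ 1 := abs_real_inner_div_norm_mul_norm_le_one x y
  have hxy : ‖x‖ * ‖y‖ * c = inner ℝ x y := by
    rcases eq_or_ne x 0 with rfl | hx
    · simp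
    rcases eq_or_ne y 0 with rfl | hy
    · simp
    have := norm_ne_zero_iff.2 hx
    have := norm_ne_zero_iff.2 hy
    rw [hc]; field_simp
  have h1 := Real.cosh_le_of_sq_eq (q := ‖x + y‖) (r := ‖x‖) (s := ‖y‖) hc1
    (by rw [norm_add_sq_real, hxy])
  rw [Real.cosh_add, Real.cosh_sub] at h1
  have hsub : Real.sinh ‖x‖ / ‖x‖ * inner ℝ x y = c * Real.sinh ‖x‖ * ‖y‖ := by
    rw [← hxy]
    rcases eq_or_ne x 0 with rfl | hx
    · simp
    have := norm_ne_zero_iff.2 hx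
    field_simp
  rw [hsub]
  have hsx : 0 ≤ Real.sinh ‖x‖ := Real.sinh_nonneg_iff.2 (norm_nonneg _)
  have hsy : 0 ≤ Real.sinh ‖y‖ - ‖y‖ := sub_nonneg.2 (Real.self_le_sinh_iff.2 (norm_nonneg _))
  have hlt := (Real.sinh_lt_cosh ‖x‖).le
  have h2 : c * Real.sinh ‖x‖ ≤ Real.cosh ‖x‖ := by
    nlinarith [(abs_le.1 hc1).2]
  have h3 := mul_le_mul_of_nonneg_right h2 hsy
  have h4 : Real.cosh ‖y‖ + Real.sinh ‖y‖ - ‖y‖ ≤ Real.exp (b ^ 2) := by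
    rw [Real.cosh_add_sinh]
    have h5 := Real.exp_le_self_add_exp_sq ‖y‖
    have h6 : Real.exp (‖y‖ ^ 2) ≤ Real.exp (b ^ 2) :=
      Real.exp_le_exp.2 (pow_le_pow_left₀ (norm_nonneg _) hy 2)
    linarith
  have h7 := mul_le_mul_of_nonneg_left h4 (Real.cosh_pos ‖x‖).le
  nlinarith

end Elementary

/-! ### Filtration of the seeds and independence from the past. -/

section Past

variable {Ω S : Type*} [mS : MeasurableSpace S]

/-- The `σ`-algebra generated by the first `c` seeds. -/
@[reducible] def seedPast (ξ : ℕ → Ω → S) (c : ℕ) : MeasurableSpace Ω :=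
  ⨆ i ∈ Set.Iio c, MeasurableSpace.comap (ξ i) mS

theorem seedPast_mono (ξ : ℕ → Ω → S) {c c' : ℕ} (h : c ≤ c') : seedPast ξ c ≤ seedPast ξ c' :=
  biSup_mono fun _ hi => lt_of_lt_of_le hi h

theorem seedPast_le [mΩ : MeasurableSpace Ω] {ξ : ℕ → Ω → S} (hξ : ∀ i, Measurable (ξ i)) (c : ℕ) : seedPast ξ c ≤ mΩ :=
  iSup₂_le fun i _ => (hξ i).comap_le

theorem measurable_seed (ξ : ℕ → Ω → S) {i c : ℕ} (h : i < c) : Measurable[seedPast ξ c] (ξ i) :=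
  (comap_measurable (ξ i)).mono
    (le_iSup₂ (f := fun i (_ : i ∈ Set.Iio c) => MeasurableSpace.comap (ξ i) mS) i h) le_rfl

theorem indepFun_seed [mΩ : MeasurableSpace Ω] {P : Measure Ω} {ξ : ℕ → Ω → S} (hξ : ∀ i, Measurable (ξ i))
    (hind : iIndepFun ξ P) {A : Type*} [MeasurableSpace A] {c : ℕ} {X : Ω → A}
    (hX : Measurable[seedPast ξ c] X) : IndepFun X (ξ c) P := by
  have h := indep_iSup_of_disjoint (fun i => (hξ i).comap_le) hind
    (S := Set.Iio c) (T := {c}) (by simp)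
  rw [IndepFun_iff_Indep]
  refine indep_of_indep_of_le_right (indep_of_indep_of_le_left h hX.comap_le) ?_
  simp

/-- Conditioning on the past in the form of Fubini: a bound valid for each frozen value of `X` is
integrated over the law of `X`. -/
theorem lintegral_comp_le_of_indepFun [mΩ : MeasurableSpace Ω] {P : Measure Ω} [IsProbabilityMeasure P] {A : Type*}
    [MeasurableSpace A] {X : Ω → A} {Y : Ω → S} (hX : Measurable X) (hY : Measurable Y)
    (hind : IndepFun X Y P) {h : A × S → ENNReal} (hh : Measurable h) {b : A → ENNReal}
    (hb : ∀ a, ∫⁻ ω, h (a, Y ω) ∂P ≤ b a) :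
    ∫⁻ ω, h (X ω, Y ω) ∂P ≤ ∫⁻ ω, b (X ω) ∂P := by
  have : IsProbabilityMeasure (P.map Y) := Measure.isProbabilityMeasure_map hY.aemeasurable
  have h1 := (indepFun_iff_map_prod_eq_prod_map_map hX.aemeasurable hY.aemeasurable).1 hind
  calc ∫⁻ ω, h (X ω, Y ω) ∂P = ∫⁻ p, h p ∂(P.map fun ω => (X ω, Y ω)) :=
        (lintegral_map hh (hX.prodMk hY)).symm
    _ = ∫⁻ a, ∫⁻ s, h (a, s) ∂(P.map Y) ∂(P.map X) := by
        rw [h1, lintegral_prod _ hh.aemeasurable]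
    _ = ∫⁻ ω, ∫⁻ s, h (X ω, s) ∂(P.map Y) ∂P := lintegral_map hh.lintegral_prod_right' hX
    _ ≤ ∫⁻ ω, b (X ω) ∂P := by
        refine lintegral_mono fun ω => ?_
        rw [lintegral_map (f := fun s => h (X ω, s)) (hh.comp measurable_prodMk_left) hY]
        exact hb _

end Past

/-! ### Exponential moments and concentration of a batch. -/

section Batch

variable {E : Type*} [NormedAddCommGroup E] [InnerProductSpace ℝ E] [CompleteSpace E]
  [MeasurableSpace E] [BorelSpace E] [SecondCountableTopology E]
  {Ω S : Type*} [mΩ : MeasurableSpace Ω] [mS : MeasurableSpace S]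
  {P : Measure Ω} [IsProbabilityMeasure P]

theorem lintegral_cosh_norm_add_le {Y : Ω → E} (hY : Measurable Y) {b : ℝ}
    (hb : ∀ᵐ ω ∂P, ‖Y ω‖ ≤ b) (h0 : ∫ ω, Y ω ∂P = 0) (x : E) :
    ∫⁻ ω, ENNReal.ofReal (Real.cosh ‖x + Y ω‖) ∂P ≤
      ENNReal.ofReal (Real.exp (b ^ 2)) * ENNReal.ofReal (Real.cosh ‖x‖) := by
  have hint : Integrable Y P := Integrable.of_bound hY.aestronglyMeasurable b hb
  have hint2 : Integrable (fun ω => Real.cosh ‖x‖ * Real.exp (b ^ 2)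
      + Real.sinh ‖x‖ / ‖x‖ * inner ℝ x (Y ω)) P :=
    (integrable_const _).add ((hint.const_inner x).const_mul _)
  have hle : ∀ᵐ ω ∂P, Real.cosh ‖x + Y ω‖ ≤ Real.cosh ‖x‖ * Real.exp (b ^ 2)
      + Real.sinh ‖x‖ / ‖x‖ * inner ℝ x (Y ω) := by
    filter_upwards [hb] with ω hω using cosh_norm_add_le hω
  have hnn : ∀ᵐ ω ∂P, 0 ≤ Real.cosh ‖x‖ * Real.exp (b ^ 2)
      + Real.sinh ‖x‖ / ‖x‖ * inner ℝ x (Y ω) := by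
    filter_upwards [hle] with ω hω using (Real.cosh_pos _).le.trans hω
  refine (lintegral_mono_ae (hle.mono fun ω hω => ENNReal.ofReal_le_ofReal hω)).trans ?_
  rw [← ofReal_integral_eq_lintegral_ofReal hint2 hnn, integral_add (integrable_const _)
    ((hint.const_inner x).const_mul _),
    integral_const_mul (Real.sinh ‖x‖ / ‖x‖), integral_inner hint, h0, inner_zero_right, ← ENNReal.ofReal_mul (Real.exp_pos _).le]
  simp [mul_comm]

theorem lintegral_exp_inner_le {Y : Ω → E} (hY : Measurable Y) {b : ℝ}
    (hb : ∀ᵐ ω ∂P, ‖Y ω‖ ≤ b) (h0 : ∫ ω, Y ω ∂P = 0) (x : E) :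
    ∫⁻ ω, ENNReal.ofReal (Real.exp (inner ℝ x (Y ω))) ∂P ≤
      ENNReal.ofReal (Real.exp (b ^ 2 * ‖x‖ ^ 2)) := by
  have hint : Integrable Y P := Integrable.of_bound hY.aestronglyMeasurable b hb
  have hint2 : Integrable (fun ω => inner ℝ x (Y ω) + Real.exp (b ^ 2 * ‖x‖ ^ 2)) P :=
    (hint.const_inner x).add (integrable_const _)
  have hle : ∀ᵐ ω ∂P, Real.exp (inner ℝ x (Y ω)) ≤
      inner ℝ x (Y ω) + Real.exp (b ^ 2 * ‖x‖ ^ 2) := by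
    filter_upwards [hb] with ω hω
    refine (Real.exp_le_self_add_exp_sq _).trans (add_le_add_right (Real.exp_le_exp.2 ?_) _)
    rw [← mul_pow]
    have h1 := abs_real_inner_le_norm x (Y ω)
    rw [← sq_abs]
    refine pow_le_pow_left₀ (abs_nonneg _) (h1.trans ?_) 2
    rw [mul_comm]; gcongr
  have hnn : ∀ᵐ ω ∂P, 0 ≤ inner ℝ x (Y ω) + Real.exp (b ^ 2 * ‖x‖ ^ 2) := by
    filter_upwards [hle] with ω hω using (Real.exp_pos _).le.trans hω
  refine (lintegral_mono_ae (hle.mono fun ω hω => ENNReal.ofReal_le_ofReal hω)).trans ?_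
  rw [← ofReal_integral_eq_lintegral_ofReal hint2 hnn, integral_add (hint.const_inner x)
    (integrable_const _), integral_inner hint, h0, inner_zero_right]
  simp

variable {ξ : ℕ → Ω → S} {e : E → S → E} {b : ℝ}

/-- `e w (ξ i)` is a centred random vector of norm at most `b` for all `i` and `w`, and the seeds
`ξ i` are independent. -/
structure IsBoundedNoise (P : Measure Ω) (ξ : ℕ → Ω → S) (e : E → S → E) (b : ℝ) : Prop where
  measurable_seed : ∀ i, Measurable (ξ i)
  indep : iIndepFun ξ P
  measurable : Measurable (Function.uncurry e)
  integral_eq_zero : ∀ i w, ∫ ω, e w (ξ i ω) ∂P = 0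
  norm_le : ∀ i w, ∀ᵐ ω ∂P, ‖e w (ξ i ω)‖ ≤ b

namespace IsBoundedNoise

omit [CompleteSpace E] [BorelSpace E] [SecondCountableTopology E] [IsProbabilityMeasure P] in
theorem comp_seed (h : IsBoundedNoise P ξ e b) (i : ℕ) (w : E) :
    Measurable fun ω => e w (ξ i ω) :=
  h.measurable.comp (measurable_const.prodMk (h.measurable_seed i))

omit [CompleteSpace E] [SecondCountableTopology E] [IsProbabilityMeasure P] in
-- The factor `μ` plays the role of the free parameter in Chernoff's method.
theorem const_smul (h : IsBoundedNoise P ξ e b) {μ : ℝ} (hμ : 0 ≤ μ) :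
    IsBoundedNoise P ξ (fun w s => μ • e w s) (μ * b) where
  measurable_seed := h.measurable_seed
  indep := h.indep
  measurable := h.measurable.const_smul μ
  integral_eq_zero i w := by rw [integral_smul, h.integral_eq_zero, smul_zero]
  norm_le i w := by
    filter_upwards [h.norm_le i w] with ω hω
    rw [norm_smul, Real.norm_of_nonneg hμ]
    gcongr

omit [CompleteSpace E] [IsProbabilityMeasure P] in
theorem measurable_sum (h : IsBoundedNoise P ξ e b) {c n d : ℕ} (hd : c + n ≤ d)
    {w : Ω → E} (hw : Measurable[seedPast ξ d] w) :
    Measurable[seedPast ξ d] fun ω => ∑ i ∈ Finset.range n, e (w ω) (ξ (c + i) ω) := by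
  refine Finset.measurable_fun_sum _ fun i hi => ?_
  exact h.measurable.comp
    (hw.prodMk (_root_.measurable_seed ξ (by have := Finset.mem_range.1 hi; omega)))

/-- The point `w` and the first `n` summands depend only on seeds before `c + n`; freezing them, the
next summand costs one factor `exp (b ^ 2)`. -/
theorem lintegral_cosh_norm_sum_le (h : IsBoundedNoise P ξ e b) {c : ℕ} {w : Ω → E}
    (hw : Measurable[seedPast ξ c] w) (n : ℕ) :
    ∫⁻ ω, ENNReal.ofReal (Real.cosh ‖∑ i ∈ Finset.range n, e (w ω) (ξ (c + i) ω)‖) ∂P ≤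
      ENNReal.ofReal (Real.exp (b ^ 2)) ^ n := by
  induction n with
  | zero => simp
  | succ n ih =>
    have hw' := hw.mono (seedPast_mono ξ (Nat.le_add_right c n)) le_rfl
    have hX := hw'.prodMk (h.measurable_sum le_rfl hw')
    have hm : Measurable fun p : (E × E) × S =>
        ENNReal.ofReal (Real.cosh ‖p.1.2 + e p.1.1 p.2‖) := by
      have : Measurable fun p : (E × E) × S => e p.1.1 p.2 :=
        h.measurable.comp (measurable_fst.fst.prodMk measurable_snd)
      exact (Real.continuous_cosh.measurable.comp
        (measurable_fst.snd.add this).norm).ennreal_ofReal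
    have hle := lintegral_comp_le_of_indepFun (P := P)
      (hX.mono (seedPast_le h.measurable_seed _) le_rfl)
      (h.measurable_seed (c + n)) (indepFun_seed h.measurable_seed h.indep hX) hm
      (b := fun a => ENNReal.ofReal (Real.exp (b ^ 2)) * ENNReal.ofReal (Real.cosh ‖a.2‖))
      (fun a => by
        simp only
        exact lintegral_cosh_norm_add_le (h.comp_seed (c + n) a.1) (h.norm_le _ _)
          (h.integral_eq_zero _ _) a.2)
    simp only [Finset.sum_range_succ]
    refine hle.trans ?_
    rw [lintegral_const_mul' _ _ ENNReal.ofReal_ne_top, pow_succ' _ n]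
    exact mul_le_mul_right ih _

/-- The last summand is integrated with the past frozen and costs `exp (b ^ 2 * ‖x‖ ^ 2)`. This
factor is known at time `c`, so it is moved into `Y` before the induction hypothesis is used. -/
theorem lintegral_exp_add_inner_sum_le (h : IsBoundedNoise P ξ e b) {c : ℕ} {w x : Ω → E}
    {Y : Ω → ℝ} (hw : Measurable[seedPast ξ c] w) (hx : Measurable[seedPast ξ c] x)
    (hY : Measurable[seedPast ξ c] Y) (n : ℕ) :
    ∫⁻ ω, ENNReal.ofReal (Real.exp (Y ω
        + inner ℝ (x ω) (∑ i ∈ Finset.range n, e (w ω) (ξ (c + i) ω)))) ∂P ≤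
      ∫⁻ ω, ENNReal.ofReal (Real.exp (Y ω + n * b ^ 2 * ‖x ω‖ ^ 2)) ∂P := by
  induction n generalizing Y with
  | zero => simp
  | succ n ih =>
    have hmono := seedPast_mono ξ (Nat.le_add_right c n)
    have hw' := hw.mono hmono le_rfl
    have hx' := hx.mono hmono le_rfl
    have hY' : Measurable[seedPast ξ (c + n)] fun ω => Y ω
        + inner ℝ (x ω) (∑ i ∈ Finset.range n, e (w ω) (ξ (c + i) ω)) :=
      (hY.mono hmono le_rfl).add (hx'.inner (h.measurable_sum le_rfl hw'))
    have hX := hY'.prodMk (hw'.prodMk hx')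
    have hm : Measurable fun p : (ℝ × E × E) × S => ENNReal.ofReal (Real.exp p.1.1) *
        ENNReal.ofReal (Real.exp (inner ℝ p.1.2.2 (e p.1.2.1 p.2))) := by
      have : Measurable fun p : (ℝ × E × E) × S => e p.1.2.1 p.2 :=
        h.measurable.comp (measurable_fst.snd.fst.prodMk measurable_snd)
      exact measurable_fst.fst.exp.ennreal_ofReal.mul
        (measurable_fst.snd.snd.inner this).exp.ennreal_ofReal
    have hle := lintegral_comp_le_of_indepFun (P := P)
      (hX.mono (seedPast_le h.measurable_seed _) le_rfl)
      (h.measurable_seed (c + n)) (indepFun_seed h.measurable_seed h.indep hX) hm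
      (b := fun a => ENNReal.ofReal (Real.exp a.1) *
        ENNReal.ofReal (Real.exp (b ^ 2 * ‖a.2.2‖ ^ 2)))
      (fun a => by
        simp only
        rw [lintegral_const_mul' _ _ ENNReal.ofReal_ne_top]
        gcongr
        exact lintegral_exp_inner_le (h.comp_seed _ _) (h.norm_le _ _)
          (h.integral_eq_zero _ _) _)
    simp only [← ENNReal.ofReal_mul (Real.exp_pos _).le, ← Real.exp_add] at hle
    have hY2 : Measurable[seedPast ξ c] fun ω => Y ω + b ^ 2 * ‖x ω‖ ^ 2 := by
      have : Measurable fun p : ℝ × E => p.1 + b ^ 2 * ‖p.2‖ ^ 2 := by fun_prop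
      exact this.comp (hY.prodMk hx)
    refine le_trans (le_of_eq ?_) (hle.trans (le_trans (le_of_eq ?_)
      ((ih hY2).trans (le_of_eq ?_))))
    · refine lintegral_congr fun ω => ?_
      rw [Finset.sum_range_succ, inner_add_right, add_assoc]
    · refine lintegral_congr fun ω => ?_
      rw [add_right_comm]
    · refine lintegral_congr fun ω => ?_
      push_cast
      ring_nf

/-- Concentration of the mean of a batch, free of the dimension. -/
theorem measure_norm_batch_gt_le (h : IsBoundedNoise P ξ e b) (hb : 0 < b) {c n : ℕ} (hn : 0 < n)
    {w : Ω → E} (hw : Measurable[seedPast ξ c] w) {l : ℝ} (hl : 0 ≤ l) :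
    P {ω | 4 * b ^ 2 * l / n <
      ‖(n : ℝ)⁻¹ • ∑ i ∈ Finset.range n, e (w ω) (ξ (c + i) ω)‖ ^ 2} ≤
      ENNReal.ofReal (2 * Real.exp (-l)) := by
  have hnr : (0 : ℝ) < n := by exact_mod_cast hn
  -- With this scale `n (μ b) ^ 2 = l`, so the expected `cosh` is at most `exp l`. On the event the
  -- scaled sum has norm at least `2 l`, hence `cosh ≥ exp (2 l) / 2`, and Markov's inequality gives
  -- `2 exp (-l)`.
  set μ : ℝ := √(l / n) / b with hμ
  have hμ0 : 0 ≤ μ := by positivity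
  have hμ2 : μ ^ 2 = l / n / b ^ 2 := by rw [hμ, div_pow, Real.sq_sqrt (by positivity)]
  have hs := h.const_smul hμ0
  have hle := hs.lintegral_cosh_norm_sum_le hw n
  rw [← ENNReal.ofReal_pow (Real.exp_pos _).le, ← Real.exp_nat_mul,
    show (n : ℝ) * (μ * b) ^ 2 = l by rw [mul_pow, hμ2]; field_simp] at hle
  have hmeas : Measurable fun ω => ∑ i ∈ Finset.range n, μ • e (w ω) (ξ (c + i) ω) :=
    (hs.measurable_sum le_rfl (hw.mono (seedPast_mono ξ (Nat.le_add_right c n)) le_rfl)).mono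
      (seedPast_le h.measurable_seed _) le_rfl
  have hM := mul_meas_ge_le_lintegral₀ (μ := P)
    (Real.continuous_cosh.measurable.comp hmeas.norm).ennreal_ofReal.aemeasurable
    (ENNReal.ofReal (Real.exp (2 * l) / 2))
  have hpos : 0 < Real.exp (2 * l) / 2 := by positivity
  have hsub : {ω | 4 * b ^ 2 * l / n <
      ‖(n : ℝ)⁻¹ • ∑ i ∈ Finset.range n, e (w ω) (ξ (c + i) ω)‖ ^ 2} ⊆
      {ω | ENNReal.ofReal (Real.exp (2 * l) / 2) ≤
        ENNReal.ofReal (Real.cosh ‖∑ i ∈ Finset.range n, μ • e (w ω) (ξ (c + i) ω)‖)} := by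
    intro ω hω
    simp only [Set.mem_ofPred_eq] at hω ⊢
    refine ENNReal.ofReal_le_ofReal ?_
    rw [← Finset.smul_sum]
    set Z := ∑ i ∈ Finset.range n, e (w ω) (ξ (c + i) ω)
    rw [norm_smul, mul_pow, Real.norm_of_nonneg (by positivity), inv_pow, inv_mul_eq_div,
      lt_div_iff₀ (by positivity)] at hω
    have h2 : (2 * l) ^ 2 ≤ ‖μ • Z‖ ^ 2 := by
      rw [norm_smul, mul_pow ‖μ‖, Real.norm_of_nonneg hμ0, hμ2]
      calc (2 * l) ^ 2 = l / n / b ^ 2 * (4 * b ^ 2 * l / n * n ^ 2) := by field_simp; ring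
        _ ≤ _ := by gcongr
    have h3 := le_of_sq_le_sq h2 (norm_nonneg _)
    have h4 : Real.exp (2 * l) ≤ Real.exp ‖μ • Z‖ := Real.exp_le_exp.2 h3
    rw [Real.cosh_eq]
    have := Real.exp_pos (-‖μ • Z‖)
    linarith
  refine (measure_mono hsub).trans ?_
  have h5 := (ENNReal.le_div_iff_mul_le (Or.inl (by simpa using hpos))
    (Or.inl ENNReal.ofReal_ne_top)).2 ((mul_comm _ _).trans_le (hM.trans hle))
  refine h5.trans (le_of_eq ?_)
  rw [← ENNReal.ofReal_div_of_pos hpos]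
  congr 1
  rw [show -l = l - 2 * l by ring, Real.exp_sub]
  field_simp

end IsBoundedNoise

end Batch

/-! ### Measurability of the iterates and high-probability analysis of one epoch. -/

section StochasticEpoch

variable {E : Type*} [NormedAddCommGroup E] [InnerProductSpace ℝ E] [CompleteSpace E]
  [MeasurableSpace E] [BorelSpace E] [SecondCountableTopology E]
  {Ω S : Type*} [mΩ : MeasurableSpace Ω] [mS : MeasurableSpace S]
  {P : Measure Ω} [IsProbabilityMeasure P] {D : Set E}
  {ξ : ℕ → Ω → S} {g : E → S → E}

omit [CompleteSpace E] mΩ in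
theorem measurable_batchMean (hg : Measurable (Function.uncurry g)) {c d B : ℕ} (hd : c + B ≤ d)
    {w : Ω → E} (hw : Measurable[seedPast ξ d] w) :
    Measurable[seedPast ξ d] fun ω => batchMean (fun j w => g w (ξ j ω)) c B (w ω) := by
  unfold batchMean
  refine Measurable.const_smul (Finset.measurable_fun_sum _ fun i hi => ?_) _
  exact hg.comp (hw.prodMk (measurable_seed ξ (by have := Finset.mem_range.1 hi; omega)))

omit [CompleteSpace E] mΩ in
-- The call counter does not depend on `ω`, so each batch reads seeds with fixed indices and the
-- iterates are adapted to `seedPast`.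
theorem measurable_extraPoint (hD : Measurable (euclideanProj D)) (η : ℝ)
    (hg : Measurable (Function.uncurry g)) {c d B : ℕ} (hd : c + B ≤ d) {s : Ω → InnerState E}
    (hc : ∀ ω, (s ω).calls = c) (hw : Measurable[seedPast ξ d] fun ω => (s ω).w) :
    Measurable[seedPast ξ d]
      fun ω => extraPoint D η (fun j w => g w (ξ j ω)) B (s ω) := by
  unfold extraPoint
  simp only [hc]
  have h : Measurable fun p : E × E => euclideanProj D (p.1 - η • p.2) :=
    hD.comp (measurable_fst.sub (measurable_snd.const_smul η))
  exact h.comp (hw.prodMk (measurable_batchMean hg hd hw))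

omit [CompleteSpace E] mΩ in
theorem measurable_innerStep (hD : Measurable (euclideanProj D)) (η : ℝ)
    (hg : Measurable (Function.uncurry g)) {c d B : ℕ} (hd : c + B + B ≤ d)
    {s : Ω → InnerState E} (hc : ∀ ω, (s ω).calls = c)
    (hw : Measurable[seedPast ξ d] fun ω => (s ω).w) :
    Measurable[seedPast ξ d]
      fun ω => (innerStep D η (fun j w => g w (ξ j ω)) B (s ω)).w := by
  have hz := measurable_extraPoint (B := B) hD η hg (by omega) hc hw
  have h : Measurable fun p : E × E => euclideanProj D (p.1 - η • p.2) :=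
    hD.comp (measurable_fst.sub (measurable_snd.const_smul η))
  have := h.comp (hw.prodMk (measurable_batchMean hg hd hz))
  simp only [innerStep, hc]
  unfold extraPoint at this
  simp only [hc] at this
  exact this

omit [CompleteSpace E] mΩ in
theorem measurable_iterate_innerStep (hD : Measurable (euclideanProj D)) (η : ℝ)
    (hg : Measurable (Function.uncurry g)) {c d B : ℕ} {s : Ω → InnerState E}
    (hc : ∀ ω, (s ω).calls = c) {t : ℕ} (hd : c + 2 * B * t ≤ d)
    (hw : Measurable[seedPast ξ d] fun ω => (s ω).w) :
    Measurable[seedPast ξ d]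
      fun ω => ((innerStep D η (fun j w => g w (ξ j ω)) B)^[t] (s ω)).w := by
  induction t with
  | zero => exact hw
  | succ t ih =>
    simp only [Function.iterate_succ_apply']
    have e : 2 * B * (t + 1) = 2 * B * t + B + B := by ring
    exact measurable_innerStep hD η hg (c := c + 2 * B * t) (by omega)
      (fun ω => by rw [iterate_innerStep_calls, hc]) (ih (by omega))

omit [CompleteSpace E] mΩ in
theorem measurable_runEpoch (hD : Measurable (euclideanProj D)) (η : ℝ)
    (hg : Measurable (Function.uncurry g)) {c B M : ℕ} {s : Ω → RunState E}
    (hc : ∀ ω, (s ω).calls = c) (hw : Measurable[seedPast ξ c] fun ω => (s ω).point) :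
    Measurable[seedPast ξ (c + 2 * B * M)]
      fun ω => (runEpoch D η M (fun j w => g w (ξ j ω)) B (s ω)).point := by
  simp only [runEpoch_point]
  refine Measurable.const_smul (Finset.measurable_fun_sum _ fun i hi => ?_) _
  have hi := Finset.mem_range.1 hi
  have e : 2 * B * (i + 1) ≤ 2 * B * M := Nat.mul_le_mul_left _ hi
  have e2 : 2 * B * (i + 1) = 2 * B * i + B + B := by ring
  exact measurable_extraPoint hD η hg (c := c + 2 * B * i) (by omega)
    (fun ω => by rw [iterate_innerStep_calls]; simp [RunState.toInner, hc])
    (measurable_iterate_innerStep (s := fun ω => (s ω).toInner) hD η hg hc (by omega)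
      (hw.mono (seedPast_mono ξ (by omega)) le_rfl))

/-- The noise of the oracle, as a function defined on the whole space. -/
noncomputable def oracleNoise (D : Set E) (g : E → S → E) (gradF : E → E) (w : E) (x : S) : E :=
  g (euclideanProj D w) x - gradF (euclideanProj D w)

/-- Composing with the projection carries the oracle assumptions from `D` to all of `E`, and makes
the gradient term continuous, hence measurable. -/
theorem isBoundedNoise_oracleNoise (hne : D.Nonempty) (hcl : IsClosed D) (hco : Convex ℝ D)
    {gradF : E → E} {L G : ℝ} (hLip : ∀ w ∈ D, ∀ w' ∈ D, ‖gradF w - gradF w'‖ ≤ L * ‖w - w'‖)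
    (hg : Measurable (Function.uncurry g)) (hξ : ∀ i, Measurable (ξ i)) (hind : iIndepFun ξ P)
    (hmean : ∀ i, ∀ w ∈ D, ∫ ω, g w (ξ i ω) ∂P = gradF w)
    (hG : ∀ i, ∀ w ∈ D, ∀ᵐ ω ∂P, ‖g w (ξ i ω)‖ ≤ G) (hgradG : ∀ w ∈ D, ‖gradF w‖ ≤ G) :
    IsBoundedNoise P ξ (oracleNoise D g gradF) (2 * G) := by
  have hproj := euclideanProj_mem hne hcl hco
  have hcont := continuous_euclideanProj hne hcl hco
  have hgrad : Continuous fun w => gradF (euclideanProj D w) := by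
    refine (LipschitzWith.of_dist_le_mul (K := L.toNNReal) fun x y => ?_).continuous
    rw [dist_eq_norm, dist_eq_norm]
    refine (hLip _ (hproj x) _ (hproj y)).trans ?_
    have := norm_euclideanProj_sub_le hne hcl hco x y
    have h2 : L ≤ L.toNNReal := Real.le_coe_toNNReal L
    exact (mul_le_mul_of_nonneg_right h2 (norm_nonneg _)).trans
      (mul_le_mul_of_nonneg_left this (NNReal.coe_nonneg _))
  refine ⟨hξ, hind, ?_, fun i w => ?_, fun i w => ?_⟩
  · exact (hg.comp ((hcont.measurable.comp measurable_fst).prodMk measurable_snd)).sub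
      (hgrad.measurable.comp measurable_fst)
  · have hm : Measurable fun ω => g (euclideanProj D w) (ξ i ω) :=
      hg.comp (measurable_const.prodMk (hξ i))
    have hint : Integrable (fun ω => g (euclideanProj D w) (ξ i ω)) P :=
      Integrable.of_bound hm.aestronglyMeasurable G (hG i _ (hproj w))
    simp only [oracleNoise]
    rw [integral_sub hint (integrable_const _), hmean i _ (hproj w)]
    simp
  · filter_upwards [hG i _ (hproj w)] with ω hω
    have := norm_sub_le (g (euclideanProj D w) (ξ i ω)) (gradF (euclideanProj D w))
    have h2 := hgradG _ (hproj w)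
    unfold oracleNoise
    linarith

omit [MeasurableSpace E] [BorelSpace E] [SecondCountableTopology E] mΩ mS in
theorem batchMean_sub_eq (hcl : IsClosed D) (hco : Convex ℝ D) (gradF : E → E) {B : ℕ}
    (hB : 0 < B) (c : ℕ) {w : E} (hw : w ∈ D) (ω : Ω) :
    batchMean (fun j w => g w (ξ j ω)) c B w - gradF w =
      (B : ℝ)⁻¹ • ∑ i ∈ Finset.range B, oracleNoise D g gradF w (ξ (c + i) ω) := by
  have hBr : (B : ℝ) ≠ 0 := by exact_mod_cast hB.ne'
  simp only [oracleNoise, euclideanProj_of_mem hcl hco hw, batchMean, Finset.sum_sub_distrib,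
    Finset.sum_const, Finset.card_range, smul_sub]
  rw [← Nat.cast_smul_eq_nsmul ℝ, smul_smul, inv_mul_cancel₀ hBr, one_smul]

/-- The exponential supermartingale of an epoch. -/
theorem lintegral_exp_epoch_le {gradF : E → E} {b lam η : ℝ} (hcl : IsClosed D) (hco : Convex ℝ D)
    (hg : Measurable (Function.uncurry g)) (hnoise : IsBoundedNoise P ξ (oracleNoise D g gradF) b)
    (hb : 0 < b) (hlam : 0 < lam) {c B : ℕ} (hB : 0 < B) {s : Ω → InnerState E}
    (hc : ∀ ω, (s ω).calls = c) (hw : Measurable[seedPast ξ c] fun ω => (s ω).w)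
    {u : E} (hu : u ∈ D) (z : ℕ → Ω → E)
    (hz : ∀ t ω, z t ω = extraPoint D η (fun j w => g w (ξ j ω)) B
      ((innerStep D η (fun j w => g w (ξ j ω)) B)^[t] (s ω))) (n : ℕ) :
    ∫⁻ ω, ENNReal.ofReal (Real.exp (lam * B / (2 * b ^ 2) * ∑ t ∈ Finset.range n,
      (inner ℝ (gradF (z t ω)
          - batchMean (fun j w => g w (ξ j ω)) (c + 2 * B * t + B) B (z t ω)) (z t ω - u)
        - lam / 2 * ‖z t ω - u‖ ^ 2))) ∂P ≤ 1 := by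
  have hne : D.Nonempty := ⟨u, hu⟩
  have hBr : (0 : ℝ) < B := by exact_mod_cast hB
  have hD := (continuous_euclideanProj hne hcl hco).measurable
  have hzD : ∀ t ω, z t ω ∈ D := fun t ω => by rw [hz]; exact extraPoint_mem hne hcl hco ..
  have hzm : ∀ t d, c + 2 * B * t + B ≤ d → Measurable[seedPast ξ d] (z t) := fun t d hd => by
    rw [show z t = _ from funext (hz t)]
    exact measurable_extraPoint hD η hg hd
      (fun ω => by rw [iterate_innerStep_calls, hc])
      (measurable_iterate_innerStep hD η hg hc (by omega)
        (hw.mono (seedPast_mono ξ (by omega)) le_rfl))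
  -- The value of `σ` for which the moment cost `B b ^ 2 (σ / B) ^ 2 ‖z - u‖ ^ 2` equals the
  -- compensator `σ lam / 2 * ‖z - u‖ ^ 2`.
  set σ := lam * B / (2 * b ^ 2) with hσ
  have hrepr : ∀ t ω, inner ℝ (gradF (z t ω)
      - batchMean (fun j w => g w (ξ j ω)) (c + 2 * B * t + B) B (z t ω)) (z t ω - u) =
      inner ℝ (-(B : ℝ)⁻¹ • (z t ω - u)) (∑ i ∈ Finset.range B,
        oracleNoise D g gradF (z t ω) (ξ (c + 2 * B * t + B + i) ω)) := fun t ω => by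
    rw [← neg_sub, batchMean_sub_eq hcl hco gradF hB _ (hzD t ω), inner_neg_left, inner_smul_left,
      inner_smul_left, real_inner_comm]
    simp
  simp only [hrepr]
  induction n with
  | zero => simp
  | succ n ih =>
    have e1 : 2 * B * (n + 1) = 2 * B * n + B + B := by ring
    have hzn := hzm n _ le_rfl
    have hx : Measurable[seedPast ξ (c + 2 * B * n + B)]
        fun ω => σ • (-(B : ℝ)⁻¹ • (z n ω - u)) := by
      have : Measurable fun p : E => σ • (-(B : ℝ)⁻¹ • (p - u)) := by fun_prop
      exact this.comp hzn
    have hsum : Measurable[seedPast ξ (c + 2 * B * n + B)] fun ω => ∑ t ∈ Finset.range n,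
        (inner ℝ (-(B : ℝ)⁻¹ • (z t ω - u)) (∑ i ∈ Finset.range B,
          oracleNoise D g gradF (z t ω) (ξ (c + 2 * B * t + B + i) ω))
        - lam / 2 * ‖z t ω - u‖ ^ 2) := by
      refine Finset.measurable_fun_sum _ fun t ht => ?_
      have ht := Finset.mem_range.1 ht
      have e : 2 * B * (t + 1) ≤ 2 * B * n := Nat.mul_le_mul_left _ ht
      have e2 : 2 * B * (t + 1) = 2 * B * t + B + B := by ring
      have h1 := hzm t (c + 2 * B * n + B) (by omega)
      have h2 := hnoise.measurable_sum (c := c + 2 * B * t + B) (n := B) (by omega) h1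
      have : Measurable fun p : E × E =>
          inner ℝ (-(B : ℝ)⁻¹ • (p.1 - u)) p.2 - lam / 2 * ‖p.1 - u‖ ^ 2 := by fun_prop
      exact this.comp (h1.prodMk h2)
    -- The earlier increments and the compensator of step `n` are all known before the second batch
    -- of that step is drawn.
    have hY : Measurable[seedPast ξ (c + 2 * B * n + B)] fun ω => σ * ∑ t ∈ Finset.range n,
        (inner ℝ (-(B : ℝ)⁻¹ • (z t ω - u)) (∑ i ∈ Finset.range B,
          oracleNoise D g gradF (z t ω) (ξ (c + 2 * B * t + B + i) ω))
        - lam / 2 * ‖z t ω - u‖ ^ 2) - σ * (lam / 2 * ‖z n ω - u‖ ^ 2) := by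
      have : Measurable fun p : ℝ × E => σ * p.1 - σ * (lam / 2 * ‖p.2 - u‖ ^ 2) := by fun_prop
      exact this.comp (hsum.prodMk hzn)
    refine le_trans (le_of_eq ?_) ((hnoise.lintegral_exp_add_inner_sum_le hzn hx hY B).trans
      (le_trans (lintegral_mono fun ω => ENNReal.ofReal_le_ofReal (Real.exp_le_exp.2 ?_)) ih))
    · refine lintegral_congr fun ω => ?_
      rw [Finset.sum_range_succ, inner_smul_left (𝕜 := ℝ) _ _ σ]
      simp only [RCLike.conj_to_real]
      congr 2
      ring
    · rw [smul_smul, norm_smul, mul_pow, Real.norm_eq_abs, sq_abs]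
      have : (B : ℝ) * b ^ 2 * ((σ * -(B : ℝ)⁻¹) ^ 2 * ‖z n ω - u‖ ^ 2)
          = σ * (lam / 2 * ‖z n ω - u‖ ^ 2) := by
        rw [hσ]; field_simp
      rw [this]
      linarith

/-- With high probability, the error of the average of an epoch is bounded by its deterministic
part plus the noise of its batches. -/
theorem measure_not_runEpoch_sub_le {F : E → ℝ} {gradF : E → E} {b η L lam l l' : ℝ}
    (hcl : IsClosed D) (hlam : 0 < lam) (hF : StrongConvexOn D lam F)
    (hgrad : ∀ w ∈ D, HasGradientWithinAt F (gradF w) D w)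
    (hLip : ∀ w ∈ D, ∀ w' ∈ D, ‖gradF w - gradF w'‖ ≤ L * ‖w - w'‖)
    (hη : 0 < η) (hηL : 3 * η ^ 2 * L ^ 2 ≤ 1) {M : ℕ} (hM : 0 < M)
    (hg : Measurable (Function.uncurry g)) (hnoise : IsBoundedNoise P ξ (oracleNoise D g gradF) b)
    (hb : 0 < b) (hl : 0 ≤ l) {c B : ℕ} (hB : 0 < B) {s : Ω → RunState E}
    (hc : ∀ ω, (s ω).calls = c) (hw : Measurable[seedPast ξ c] fun ω => (s ω).point)
    (hs : ∀ ω, (s ω).point ∈ D) {u : E} (hu : u ∈ D) :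
    P {ω | ¬ F (runEpoch D η M (fun j w => g w (ξ j ω)) B (s ω)).point - F u ≤
      ‖(s ω).point - u‖ ^ 2 / (2 * M * η) + 3 * η * (4 * b ^ 2 * l / B)
        + 2 * b ^ 2 * l' / (lam * B) / M} ≤
      ENNReal.ofReal (4 * M * Real.exp (-l) + Real.exp (-l')) := by
  have hco := hF.1
  have hne : D.Nonempty := ⟨u, hu⟩
  have hBr : (0 : ℝ) < B := by exact_mod_cast hB
  have hD := (continuous_euclideanProj hne hcl hco).measurable
  let R : ℕ → Ω → InnerState E := fun t ω =>
    (innerStep D η (fun j w => g w (ξ j ω)) B)^[t] (s ω).toInner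
  let z : ℕ → Ω → E := fun t ω => extraPoint D η (fun j w => g w (ξ j ω)) B (R t ω)
  have hRc : ∀ t ω, (R t ω).calls = c + 2 * B * t := fun t ω => by
    simp only [R]; rw [iterate_innerStep_calls]; simp [RunState.toInner, hc]
  have hRD : ∀ t ω, (R t ω).w ∈ D := fun t ω => iterate_innerStep_mem hcl hco η _ B (hs ω) t
  have hzD : ∀ t ω, z t ω ∈ D := fun t ω => extraPoint_mem hne hcl hco ..
  have hRm : ∀ t, Measurable[seedPast ξ (c + 2 * B * t)] fun ω => (R t ω).w := fun t =>
    measurable_iterate_innerStep (s := fun ω => (s ω).toInner) hD η hg hc le_rfl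
      (hw.mono (seedPast_mono ξ (by omega)) le_rfl)
  have hzm : ∀ t, Measurable[seedPast ξ (c + 2 * B * t + B)] (z t) := fun t =>
    measurable_extraPoint hD η hg le_rfl (hRc t)
      ((hRm t).mono (seedPast_mono ξ (by omega)) le_rfl)
  -- Outside these `2M + 1` events `runEpoch_sub_le` applies. Each of the `2M` batch events costs `2
  -- exp (-l)`; `bad₃` costs `exp (-l')` by Markov's inequality for the supermartingale.
  let bad₁ : ℕ → Set Ω := fun t => {ω | 4 * b ^ 2 * l / B < ‖(B : ℝ)⁻¹ • ∑ i ∈ Finset.range B,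
    oracleNoise D g gradF (R t ω).w (ξ (c + 2 * B * t + i) ω)‖ ^ 2}
  let bad₂ : ℕ → Set Ω := fun t => {ω | 4 * b ^ 2 * l / B < ‖(B : ℝ)⁻¹ • ∑ i ∈ Finset.range B,
    oracleNoise D g gradF (z t ω) (ξ (c + 2 * B * t + B + i) ω)‖ ^ 2}
  let Q : Ω → ℝ := fun ω => ∑ t ∈ Finset.range M, (inner ℝ (gradF (z t ω)
          - batchMean (fun j w => g w (ξ j ω)) (c + 2 * B * t + B) B (z t ω)) (z t ω - u)
        - lam / 2 * ‖z t ω - u‖ ^ 2)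
  let σ := lam * B / (2 * b ^ 2)
  have hσ : 0 < σ := by positivity
  let bad₃ : Set Ω := {ω | 2 * b ^ 2 * l' / (lam * B) < Q ω}
  have hb₁ : ∀ t, P (bad₁ t) ≤ ENNReal.ofReal (2 * Real.exp (-l)) := fun t =>
    hnoise.measure_norm_batch_gt_le hb hB (hRm t) hl
  have hb₂ : ∀ t, P (bad₂ t) ≤ ENNReal.ofReal (2 * Real.exp (-l)) := fun t =>
    hnoise.measure_norm_batch_gt_le hb hB (hzm t) hl
  have hQm : Measurable Q := by
    refine Finset.measurable_fun_sum _ fun t _ => ?_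
    have h1 : Measurable (z t) := (hzm t).mono (seedPast_le hnoise.measurable_seed _) le_rfl
    have h2 : Measurable fun ω =>
        batchMean (fun j w => g w (ξ j ω)) (c + 2 * B * t + B) B (z t ω) :=
      (measurable_batchMean hg le_rfl ((hzm t).mono
        (seedPast_mono ξ (Nat.le_add_right _ B)) le_rfl)).mono
        (seedPast_le hnoise.measurable_seed _) le_rfl
    have h3 : Measurable fun ω => (B : ℝ)⁻¹ • ∑ i ∈ Finset.range B,
        oracleNoise D g gradF (z t ω) (ξ (c + 2 * B * t + B + i) ω) :=
      (Finset.measurable_fun_sum _ fun i _ => hnoise.measurable.comp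
        (h1.prodMk (hnoise.measurable_seed _))).const_smul _
    -- Measurability of `gradF` off `D` is not assumed, so the difference is rewritten through the
    -- noise.
    have h4 : ∀ ω, gradF (z t ω) -
        batchMean (fun j w => g w (ξ j ω)) (c + 2 * B * t + B) B (z t ω) =
        -((B : ℝ)⁻¹ • ∑ i ∈ Finset.range B,
          oracleNoise D g gradF (z t ω) (ξ (c + 2 * B * t + B + i) ω)) := fun ω => by
      rw [← batchMean_sub_eq hcl hco gradF hB _ (hzD t ω), neg_sub]
    simp only [h4]
    exact (h3.neg.inner (h1.sub_const u)).sub (((h1.sub_const u).norm.pow_const 2).const_mul _)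
  have hb₃ : P bad₃ ≤ ENNReal.ofReal (Real.exp (-l')) := by
    have hE := lintegral_exp_epoch_le (η := η) hcl hco hg hnoise hb hlam hB
      (s := fun ω => (s ω).toInner) hc hw hu z (fun _ _ => rfl) M
    have hMk := mul_meas_ge_le_lintegral₀ (μ := P)
      (f := fun ω => ENNReal.ofReal (Real.exp (σ * Q ω)))
      (hQm.const_mul σ).exp.ennreal_ofReal.aemeasurable (ENNReal.ofReal (Real.exp l'))
    have hsub : bad₃ ⊆ {ω | ENNReal.ofReal (Real.exp l') ≤
        ENNReal.ofReal (Real.exp (σ * Q ω))} := by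
      intro ω hω
      refine ENNReal.ofReal_le_ofReal (Real.exp_le_exp.2 ?_)
      have h1 : σ * (2 * b ^ 2 * l' / (lam * B)) = l' := by simp only [σ]; field_simp
      rw [← h1]
      exact mul_le_mul_of_nonneg_left (le_of_lt hω) hσ.le
    refine (measure_mono hsub).trans ?_
    have hpos := Real.exp_pos l'
    have h5 := (ENNReal.le_div_iff_mul_le (Or.inl (by simpa using hpos))
      (Or.inl ENNReal.ofReal_ne_top)).2 ((mul_comm _ _).trans_le (hMk.trans hE))
    refine h5.trans (le_of_eq ?_)
    rw [Real.exp_neg, ENNReal.ofReal_inv_of_pos hpos, one_div]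
  have hsub : {ω | ¬ F (runEpoch D η M (fun j w => g w (ξ j ω)) B (s ω)).point - F u ≤
      ‖(s ω).point - u‖ ^ 2 / (2 * M * η) + 3 * η * (4 * b ^ 2 * l / B)
        + 2 * b ^ 2 * l' / (lam * B) / M} ⊆
      (⋃ t ∈ Finset.range M, (bad₁ t ∪ bad₂ t)) ∪ bad₃ := by
    intro ω hω
    by_contra hcon
    simp only [Set.mem_union, Set.mem_iUnion, not_or, not_exists] at hcon
    obtain ⟨h12, h3⟩ := hcon
    refine hω (runEpoch_sub_le hcl hlam hF hgrad hLip hη hηL hM _ B (s ω) (hs ω) hu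
      (fun t => R t ω) (fun t => rfl) (fun t ht => ?_) (fun t ht => ?_) ?_)
    · have := (h12 t (Finset.mem_range.2 ht)).1
      rw [hRc, batchMean_sub_eq hcl hco gradF hB _ (hRD t ω)]
      exact not_lt.1 this
    · have := (h12 t (Finset.mem_range.2 ht)).2
      change ‖batchMean _ _ _ (z t ω) - gradF (z t ω)‖ ^ 2 ≤ _
      rw [hRc, batchMean_sub_eq hcl hco gradF hB _ (hzD t ω)]
      exact not_lt.1 this
    · simp only [hRc]
      exact not_lt.1 h3
  calc _ ≤ P ((⋃ t ∈ Finset.range M, (bad₁ t ∪ bad₂ t)) ∪ bad₃) := measure_mono hsub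
    _ ≤ ∑ t ∈ Finset.range M, (P (bad₁ t) + P (bad₂ t)) + P bad₃ :=
        (measure_union_le _ _).trans (add_le_add_left ((measure_biUnion_finset_le _ _).trans
          (Finset.sum_le_sum fun t _ => measure_union_le _ _)) _)
    _ ≤ ∑ t ∈ Finset.range M, (ENNReal.ofReal (2 * Real.exp (-l))
          + ENNReal.ofReal (2 * Real.exp (-l))) + ENNReal.ofReal (Real.exp (-l')) :=
        add_le_add (Finset.sum_le_sum fun t _ => add_le_add (hb₁ t) (hb₂ t)) hb₃
    _ = _ := by
        rw [Finset.sum_const, Finset.card_range, nsmul_eq_mul, ← ENNReal.ofReal_natCast,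
          ← ENNReal.ofReal_add (by positivity) (by positivity),
          ← ENNReal.ofReal_mul (by positivity),
          ← ENNReal.ofReal_add (by positivity) (by positivity)]
        congr 1
        ring

end StochasticEpoch

/-! ### Number of epochs and size of the parameters. -/

section Parameters

theorem batchSize_eq (B₁ n : ℕ) : batchSize B₁ n = 2 ^ n * B₁ := by
  induction n with
  | zero => simp [batchSize]
  | succ n ih => rw [batchSize, ih]; ring

theorem sum_batchSize (B₁ n : ℕ) :
    (∑ i ∈ Finset.range n, batchSize B₁ i : ℕ) = (B₁ : ℝ) * (2 ^ n - 1) := by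
  induction n with
  | zero => simp
  | succ n ih => rw [Finset.sum_range_succ, Nat.cast_add, ih, batchSize_eq]; push_cast; ring

section StateAfter

variable {E : Type*} [NormedAddCommGroup E] [InnerProductSpace ℝ E]

theorem stateAfter_calls (D : Set E) (η : ℝ) (M B₁ : ℕ) (w₁ : E) (g : ℕ → E → E) (n : ℕ) :
    (stateAfter D η M B₁ w₁ g n).calls = 2 * M * ∑ i ∈ Finset.range n, batchSize B₁ i := by
  induction n with
  | zero => simp [stateAfter]
  | succ n ih => rw [stateAfter, runEpoch_calls, ih, Finset.sum_range_succ]; ring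

theorem stateAfter_projections (D : Set E) (η : ℝ) (M B₁ : ℕ) (w₁ : E) (g : ℕ → E → E) (n : ℕ) :
    (stateAfter D η M B₁ w₁ g n).projections = 2 * M * n := by
  induction n with
  | zero => simp [stateAfter]
  | succ n ih => rw [stateAfter, runEpoch_projections, ih]; ring

end StateAfter

theorem le_kDagger_iff {T : ℕ} {α : ℝ} (hα : 0 < α) (n : ℕ) :
    n ≤ kDagger T α ↔ (2 : ℝ) ^ n ≤ (T : ℝ) / (8 * α) + 1 := by
  have h1 : (0 : ℝ) ≤ (T : ℝ) / (8 * α) := by positivity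
  rw [kDagger, Nat.le_floor_iff (Real.logb_nonneg one_lt_two (by linarith)),
    Real.le_logb_iff_rpow_le one_lt_two (by linarith), Real.rpow_natCast]

/-- Since `M B₁ = 4 α`, the first `n` epochs use `8 α (2 ^ n - 1)` calls. -/
theorem two_mul_sum_batchSize_le_iff {M B₁ T : ℕ} {α : ℝ} (hα : 0 < α)
    (hMB : (M : ℝ) * B₁ = 4 * α) (n : ℕ) :
    2 * M * ∑ i ∈ Finset.range n, batchSize B₁ i ≤ T ↔ n ≤ kDagger T α := by
  rw [le_kDagger_iff hα, ← @Nat.cast_le ℝ, Nat.cast_mul, sum_batchSize, ← sub_le_iff_le_add,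
    le_div_iff₀ (by positivity)]
  push_cast
  rw [show 2 * (M : ℝ) * (B₁ * (2 ^ n - 1)) = (2 ^ n - 1) * (8 * α) by
    linear_combination (2 * (2 ^ n - 1)) * hMB]

theorem numPasses_eq_kDagger {M B₁ T : ℕ} {α : ℝ} (hα : 0 < α)
    (hMB : (M : ℝ) * B₁ = 4 * α) : numPasses M B₁ T = kDagger T α := by
  -- The test after `n` passes already counts epoch `n + 1`; it fails when `n + 1 > k†`, that is, `n
  -- ≥ k†`.
  have : {n : ℕ | ¬ 2 * M * ∑ i ∈ Finset.range (n + 1), batchSize B₁ i ≤ T} =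
      Set.Ici (kDagger T α) := by
    ext n
    rw [Set.mem_ofPred_eq, two_mul_sum_batchSize_le_iff hα hMB, Set.mem_Ici]
    omega
  rw [numPasses, this, csInf_Ici]

theorem eight_mul_le_of_one_le_kDagger {T : ℕ} {α : ℝ} (hα : 0 < α) (h : 1 ≤ kDagger T α) :
    8 * α ≤ T := by
  rw [le_kDagger_iff hα, ← sub_le_iff_le_add, le_div_iff₀ (by positivity)] at h
  linarith

theorem deltaTilde_pos {T : ℕ} {δ α : ℝ} (hδ : 0 < δ) (hk : 1 ≤ kDagger T α) :
    0 < deltaTilde T δ α := by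
  have : (1 : ℝ) ≤ kDagger T α := by exact_mod_cast hk
  unfold deltaTilde
  positivity

theorem deltaTilde_le_one {T : ℕ} {δ α : ℝ} (hδ : δ < 1) (hk : 1 ≤ kDagger T α) :
    deltaTilde T δ α ≤ 1 := by
  have : (1 : ℝ) ≤ kDagger T α := by exact_mod_cast hk
  rw [deltaTilde, div_le_one (by positivity)]
  linarith

theorem one_le_log_div {M : ℕ} (hM : 0 < M) {d : ℝ} (hd : 0 < d) (hd1 : d ≤ 1) :
    1 ≤ Real.log (8 * (M : ℝ) / d) := by
  have hMr : (1 : ℝ) ≤ M := by exact_mod_cast hM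
  rw [Real.le_log_iff_exp_le (by positivity), le_div_iff₀ hd]
  have := Real.exp_one_lt_d9
  nlinarith [Real.exp_pos 1]

/-- The logarithm is at least `1`, so its square dominates it. The probability estimate needs only
this linear bound. -/
theorem alphaExpr_ge (L lam : ℝ) {M : ℕ} (hM : 0 < M) {T : ℕ} {δ α : ℝ} (hδ : 0 < δ) (hδ1 : δ < 1)
    (hk : 1 ≤ kDagger T α) :
    400 * Real.log (8 * (M : ℝ) / deltaTilde T δ α) ≤ alphaExpr L lam M T δ α := by
  have h := one_le_log_div hM (deltaTilde_pos hδ hk) (deltaTilde_le_one hδ1 hk)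
  refine le_trans ?_ (le_max_left _ _)
  nlinarith

/-- Lower powers of `X` are raised to the fourth using `X / x₀ ≥ 1`. -/
theorem max_sq_log_le {x₀ X a c p q : ℝ} (hx₀ : 0 < x₀) (hX : x₀ ≤ X) (hp : 0 ≤ p)
    (hpa : p ≤ a * X) (hq : 0 ≤ q) (hqc : q ≤ c * X) :
    max (400 * p ^ 2) (1 + 64 * p ^ 2 * (q + 4 / 9 * q ^ 2)) ≤
      (400 * a ^ 2 / x₀ ^ 2 + 1 / x₀ ^ 4 + 64 * a ^ 2 * (c / x₀ + 4 / 9 * c ^ 2)) * X ^ 4 := by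
  have hXpos : 0 < X := hx₀.trans_le hX
  have hc : 0 ≤ c := nonneg_of_mul_nonneg_left (hq.trans hqc) hXpos
  have h1 : 1 ≤ X / x₀ := (one_le_div hx₀).2 hX
  have hp2 : p ^ 2 ≤ a ^ 2 * X ^ 2 := by rw [← mul_pow]; exact pow_le_pow_left₀ hp hpa 2
  have hq2 : q ^ 2 ≤ c ^ 2 * X ^ 2 := by rw [← mul_pow]; exact pow_le_pow_left₀ hq hqc 2
  have hA : 400 * p ^ 2 ≤ 400 * a ^ 2 / x₀ ^ 2 * X ^ 4 := by
    calc 400 * p ^ 2 ≤ 400 * (a ^ 2 * X ^ 2) * 1 := by linarith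
      _ ≤ 400 * (a ^ 2 * X ^ 2) * (X / x₀) ^ 2 := by gcongr; exact one_le_pow₀ h1
      _ = _ := by field_simp
  have hB : 1 ≤ 1 / x₀ ^ 4 * X ^ 4 := by
    rw [one_div_mul_eq_div, ← div_pow]; exact one_le_pow₀ h1
  have hqX : q ≤ c / x₀ * X ^ 2 := by
    calc q ≤ c * X * 1 := by linarith
      _ ≤ c * X * (X / x₀) := by gcongr
      _ = _ := by field_simp
  have hC : 64 * p ^ 2 * (q + 4 / 9 * q ^ 2) ≤
      64 * a ^ 2 * (c / x₀ + 4 / 9 * c ^ 2) * X ^ 4 := by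
    calc 64 * p ^ 2 * (q + 4 / 9 * q ^ 2)
        ≤ 64 * (a ^ 2 * X ^ 2) * (c / x₀ * X ^ 2 + 4 / 9 * (c ^ 2 * X ^ 2)) := by gcongr
      _ = _ := by ring
  have hA0 : 0 ≤ 400 * a ^ 2 / x₀ ^ 2 * X ^ 4 := by positivity
  have hC0 : 0 ≤ 64 * a ^ 2 * (c / x₀ + 4 / 9 * c ^ 2) * X ^ 4 := by positivity
  rw [add_mul, add_mul]
  exact max_le (by linarith) (by linarith)

/-- A uniform positive lower bound for `X` when `T ≥ 3`, which lets additive constants be absorbed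
into multiples of `X`. -/
theorem log_log_three_pos : 0 < Real.log (Real.log 3) := by
  refine Real.log_pos ((Real.lt_log_iff_exp_lt (by norm_num)).2 ?_)
  have := Real.exp_one_lt_d9
  linarith

theorem log_log_three_le_logFactor {T : ℕ} {δ : ℝ} (hT : 3 ≤ T) (hδ : 0 < δ) (hδ1 : δ < 1) :
    Real.log (Real.log 3) ≤ logFactor T δ := by
  have hTr : (3 : ℝ) ≤ T := by exact_mod_cast hT
  have h1 : 0 < Real.log 3 := Real.log_pos (by norm_num)
  have h2 : Real.log 3 ≤ Real.log T := Real.log_le_log (by norm_num) hTr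
  have h3 : 0 ≤ Real.log (1 / δ) := Real.log_nonneg ((one_le_div hδ).2 hδ1.le)
  have h4 := Real.log_le_log h1 h2
  unfold logFactor
  linarith

theorem one_le_log_of_three_le {T : ℕ} (hT : 3 ≤ T) : 1 ≤ Real.log T := by
  have hTr : (3 : ℝ) ≤ T := by exact_mod_cast hT
  rw [Real.le_log_iff_exp_le (by positivity)]
  have := Real.exp_one_lt_d9
  linarith

theorem kDagger_le {T : ℕ} {α : ℝ} (hT : 3 ≤ T) (hα : 1 ≤ α) :
    (kDagger T α : ℝ) ≤ 2 * Real.log T := by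
  have hTr : (3 : ℝ) ≤ T := by exact_mod_cast hT
  have h1 : (T : ℝ) / (8 * α) + 1 ≤ T := by
    have : (T : ℝ) / (8 * α) ≤ T / 8 := by
      apply div_le_div_of_nonneg_left <;> linarith
    linarith
  have h0 : (0 : ℝ) ≤ (T : ℝ) / (8 * α) := by positivity
  have hlog := Real.log_two_gt_d9
  have hlT := one_le_log_of_three_le hT
  calc (kDagger T α : ℝ) ≤ Real.logb 2 ((T : ℝ) / (8 * α) + 1) :=
        Nat.floor_le (Real.logb_nonneg one_lt_two (by linarith))
    _ ≤ Real.logb 2 T := Real.logb_le_logb_of_le one_lt_two (by linarith) h1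
    _ ≤ 2 * Real.log T := by
        rw [Real.logb, div_le_iff₀ (by linarith)]
        nlinarith

theorem four_mul_div_eq {L lam : ℝ} {M : ℕ} (hM0 : 0 < M) (hM : (M : ℝ) * (stepSize L * lam) = 4)
    (T : ℕ) : 4 * (M : ℝ) * (T : ℝ) / (stepSize L * lam) = (M : ℝ) ^ 2 * T := by
  have hMr : (0 : ℝ) < M := by exact_mod_cast hM0
  have h : stepSize L * lam = 4 / M := by rw [eq_div_iff hMr.ne']; linarith
  rw [h]
  field_simp

theorem one_le_shellCount {L lam : ℝ} {M T : ℕ} (hM0 : 0 < M)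
    (hM : (M : ℝ) * (stepSize L * lam) = 4) (hT : 3 ≤ T) : 1 ≤ shellCount L lam M T := by
  have hMr : (1 : ℝ) ≤ M := by exact_mod_cast hM0
  have hTr : (3 : ℝ) ≤ T := by exact_mod_cast hT
  rw [shellCount, four_mul_div_eq hM0 hM, Nat.one_le_ceil_iff]
  refine Real.logb_pos one_lt_two ?_
  nlinarith

theorem shellCount_le {L lam : ℝ} {M T : ℕ} (hM0 : 0 < M)
    (hM : (M : ℝ) * (stepSize L * lam) = 4) (hT : 3 ≤ T) :
    (shellCount L lam M T : ℝ) ≤ (4 * Real.log M + 3) * Real.log T := by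
  have hMr : (1 : ℝ) ≤ M := by exact_mod_cast hM0
  have hTr : (3 : ℝ) ≤ T := by exact_mod_cast hT
  have hlog := Real.log_two_gt_d9
  have hlT := one_le_log_of_three_le hT
  have hlM : 0 ≤ Real.log M := Real.log_nonneg hMr
  rw [shellCount, four_mul_div_eq hM0 hM]
  have h1 : (1 : ℝ) ≤ (M : ℝ) ^ 2 * T := by nlinarith
  refine (Nat.ceil_lt_add_one (Real.logb_nonneg one_lt_two h1)).le.trans ?_
  have h2 : Real.logb 2 ((M : ℝ) ^ 2 * T) ≤ 2 * (2 * Real.log M + Real.log T) := by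
    rw [Real.logb, Real.log_mul (by positivity) (by positivity), Real.log_pow,
      div_le_iff₀ (by linarith)]
    push_cast
    nlinarith
  nlinarith [mul_nonneg hlM (sub_nonneg.2 hlT)]

/-- Orders of magnitude of the parameters. -/
theorem exists_parameter_bound {L lam : ℝ} {M : ℕ} (hM0 : 0 < M)
    (hM : (M : ℝ) * (stepSize L * lam) = 4) :
    ∃ K : ℝ, 0 < K ∧ ∀ (T : ℕ) (δ α : ℝ), 3 ≤ T → 0 < δ → δ < 1 → 1 ≤ α → 1 ≤ kDagger T α →
      (kDagger T α : ℝ) ≤ K * Real.log T ∧ (shellCount L lam M T : ℝ) ≤ K * Real.log T ∧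
        alphaExpr L lam M T δ α ≤ K * logFactor T δ ^ 4 := by
  have hMr : (1 : ℝ) ≤ M := by exact_mod_cast hM0
  have hlM : 0 ≤ Real.log M := Real.log_nonneg hMr
  set x₀ := Real.log (Real.log 3) with hx₀
  have hx₀pos : 0 < x₀ := log_log_three_pos
  set K₁ := 4 * Real.log M + 3 with hK₁
  -- From `8M/δ̃ ≤ 16 M log T / δ` and `4N/δ̃ ≤ 8 K₁ (log T) ^ 2 / δ`, the two logarithms are at
  -- most `log (16 M) + X` and `log (8 K₁) + 2 X`.
  set a := Real.log (16 * M) / x₀ + 1 with ha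
  set c := Real.log (8 * K₁) / x₀ + 2 with hc
  have hl16 : 0 ≤ Real.log (16 * M) := Real.log_nonneg (by linarith)
  have hl8 : 0 ≤ Real.log (8 * K₁) := Real.log_nonneg (by linarith)
  have hc0 : 0 ≤ c := by positivity
  set K₂ := 400 * a ^ 2 / x₀ ^ 2 + 1 / x₀ ^ 4 + 64 * a ^ 2 * (c / x₀ + 4 / 9 * c ^ 2) with hK₂
  have hK₂0 : 0 ≤ K₂ := by positivity
  refine ⟨K₁ + K₂, by linarith, fun T δ α hT hδ hδ1 hα hk => ?_⟩
  have hlT := one_le_log_of_three_le hT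
  have hkr : (1 : ℝ) ≤ kDagger T α := by exact_mod_cast hk
  have hN : (1 : ℝ) ≤ shellCount L lam M T := by exact_mod_cast one_le_shellCount hM0 hM hT
  have hk2 := kDagger_le hT hα
  have hN2 := shellCount_le hM0 hM hT
  have hX := log_log_three_le_logFactor hT hδ hδ1
  rw [← hx₀] at hX
  have hd := deltaTilde_pos (α := α) hδ hk
  have hd1 := deltaTilde_le_one (α := α) hδ1 hk
  have hXdef : logFactor T δ = Real.log (Real.log T) + Real.log (1 / δ) := rfl
  have hlogδ : 0 ≤ Real.log (1 / δ) := Real.log_nonneg ((one_le_div hδ).2 hδ1.le)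
  have hllT : 0 ≤ Real.log (Real.log T) := Real.log_nonneg hlT
  refine ⟨by nlinarith, by nlinarith, ?_⟩
  have hp0 : 0 ≤ Real.log (8 * (M : ℝ) / deltaTilde T δ α) :=
    zero_le_one.trans (one_le_log_div hM0 hd hd1)
  have hq0 : 0 ≤ Real.log (4 * (shellCount L lam M T : ℝ) / deltaTilde T δ α) :=
    Real.log_nonneg ((one_le_div hd).2 (by linarith))
  have habs : ∀ A : ℝ, 0 ≤ A → A ≤ A / x₀ * logFactor T δ := fun A hA => by
    rw [div_mul_eq_mul_div, le_div_iff₀ hx₀pos]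
    exact mul_le_mul_of_nonneg_left hX hA
  have hpa : Real.log (8 * (M : ℝ) / deltaTilde T δ α) ≤ a * logFactor T δ := by
    have h1 : 8 * (M : ℝ) / deltaTilde T δ α ≤ 16 * M * (Real.log T * (1 / δ)) := by
      rw [deltaTilde, div_div_eq_mul_div, mul_one_div, ← mul_div_assoc]
      gcongr ?_ / δ
      nlinarith
    refine (Real.log_le_log (by positivity) h1).trans ?_
    rw [Real.log_mul (x := 16 * M) (by positivity) (by positivity),
      Real.log_mul (x := Real.log T) (by positivity) (by positivity), ← hXdef, ha, add_mul, one_mul]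
    linarith [habs _ hl16]
  have hqc : Real.log (4 * (shellCount L lam M T : ℝ) / deltaTilde T δ α) ≤
      c * logFactor T δ := by
    have h1 : 4 * (shellCount L lam M T : ℝ) / deltaTilde T δ α ≤
        8 * K₁ * (Real.log T * (Real.log T * (1 / δ))) := by
      rw [deltaTilde, div_div_eq_mul_div, mul_one_div, ← mul_div_assoc, ← mul_div_assoc]
      gcongr ?_ / δ
      calc 4 * (shellCount L lam M T : ℝ) * kDagger T α
          ≤ 4 * (K₁ * Real.log T) * (2 * Real.log T) := by gcongr
        _ = _ := by ring
    have hK₁pos : 0 < K₁ := by positivity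
    refine (Real.log_le_log (by positivity) h1).trans ?_
    rw [Real.log_mul (x := 8 * K₁) (by positivity) (by positivity),
      Real.log_mul (x := Real.log T) (y := Real.log T * (1 / δ)) (by positivity) (by positivity),
      Real.log_mul (x := Real.log T) (by positivity) (by positivity), ← hXdef, hc, add_mul]
    linarith [habs _ hl8]
  refine (max_sq_log_le hx₀pos hX hp0 hpa hq0 hqc).trans ?_
  exact mul_le_mul_of_nonneg_right (by linarith) (by positivity)

/-- There is an admissible `α` of the stated order with an integral batch size. -/
theorem exists_admissible {L lam : ℝ} {M : ℕ} (hM0 : 0 < M)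
    (hM : (M : ℝ) * (stepSize L * lam) = 4) {K C : ℝ} (hK : 0 < K)
    (hKb : ∀ (T : ℕ) (δ α : ℝ), 3 ≤ T → 0 < δ → δ < 1 → 1 ≤ α → 1 ≤ kDagger T α →
      alphaExpr L lam M T δ α ≤ K * logFactor T δ ^ 4)
    (hC : 8 * (K + (1 + M / 4) / Real.log (Real.log 3) ^ 4) ≤ C) {T : ℕ} {δ : ℝ} (hδ : 0 < δ)
    (hδ1 : δ < 1) (hT : 3 ≤ T) (hCT : C * logFactor T δ ^ 4 ≤ T) :
    ∃ (α : ℝ) (B₁ : ℕ), 0 < α ∧ (B₁ : ℝ) = α * stepSize L * lam ∧ 1 ≤ kDagger T α ∧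
      alphaExpr L lam M T δ α ≤ α ∧ α ≤ C * logFactor T δ ^ 4 := by
  have hMr : (0 : ℝ) < M := by exact_mod_cast hM0
  have hx₀ := log_log_three_pos
  have hX := log_log_three_le_logFactor hT hδ hδ1
  set x₀ := Real.log (Real.log 3)
  set X := logFactor T δ
  have hX4 : x₀ ^ 4 ≤ X ^ 4 := pow_le_pow_left₀ hx₀.le hX 4
  have hKX : 0 ≤ K * X ^ 4 := by positivity
  have hceil := Nat.le_ceil (4 * (K * X ^ 4 + 1) / M)
  have hceil2 := Nat.ceil_lt_add_one (a := 4 * (K * X ^ 4 + 1) / M) (by positivity)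
  -- Rounding up gives `α = B₁ M / 4 ≥ K X ^ 4 + 1` and overshoots by less than `M / 4`. The bound
  -- on `alphaExpr` is uniform in `α ≥ 1`, so no fixed-point equation has to be solved.
  set B₁ := ⌈4 * (K * X ^ 4 + 1) / M⌉₊
  rw [div_le_iff₀ hMr] at hceil
  rw [← sub_lt_iff_lt_add, lt_div_iff₀ hMr] at hceil2
  set α : ℝ := B₁ * M / 4 with hαdef
  have hαge : K * X ^ 4 + 1 ≤ α := by rw [hαdef]; linarith
  -- The factor `8` yields `8 α ≤ T`, hence `k† ≥ 1`.
  have hαle : 8 * α ≤ C * X ^ 4 := by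
    have h1 : 1 + (M : ℝ) / 4 ≤ (1 + M / 4) / x₀ ^ 4 * X ^ 4 := by
      rw [div_mul_eq_mul_div, le_div_iff₀ (by positivity)]
      gcongr
    have h2 := mul_le_mul_of_nonneg_right hC (by positivity : 0 ≤ X ^ 4)
    rw [hαdef]
    linarith
  have hα : 0 < α := by linarith
  have hk : 1 ≤ kDagger T α := by
    rw [le_kDagger_iff hα, ← sub_le_iff_le_add, le_div_iff₀ (by positivity)]
    linarith
  refine ⟨α, B₁, hα, ?_, hk, ?_, by linarith⟩
  · rw [hαdef]; linear_combination (-(B₁ : ℝ) / 4) * hM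
  · exact (hKb T δ α hT hδ hδ1 (by linarith) hk).trans (by linarith)

end Parameters

/-! ### Induction over the epochs. -/

section Convergence

variable {E : Type*} [NormedAddCommGroup E] [InnerProductSpace ℝ E] [CompleteSpace E]
  [MeasurableSpace E] [BorelSpace E] [SecondCountableTopology E]
  {Ω S : Type*} [mΩ : MeasurableSpace Ω] [mS : MeasurableSpace S]
  {P : Measure Ω} [IsProbabilityMeasure P] {D : Set E}
  {ξ : ℕ → Ω → S} {g : E → S → E}

omit [CompleteSpace E] mΩ in
theorem measurable_stateAfter (hD : Measurable (euclideanProj D)) (η : ℝ)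
    (hg : Measurable (Function.uncurry g)) (M B₁ : ℕ) (w₁ : E) (n : ℕ) :
    Measurable[seedPast ξ (2 * M * ∑ i ∈ Finset.range n, batchSize B₁ i)]
      fun ω => (stateAfter D η M B₁ w₁ (fun j w => g w (ξ j ω)) n).point := by
  induction n with
  | zero => exact measurable_const
  | succ n ih =>
    have := measurable_runEpoch (B := batchSize B₁ n) (M := M) hD η hg
      (fun ω => stateAfter_calls D η M B₁ w₁ (fun j w => g w (ξ j ω)) n) ih
    refine this.mono (seedPast_mono ξ (le_of_eq ?_)) le_rfl
    rw [Finset.sum_range_succ]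
    ring

/-- The error bound is halved by an epoch. -/
theorem epoch_bound_le {η lam G α l l' d B M p : ℝ} {n : ℕ} (hη : 0 < η) (hlam : 0 < lam)
    (hα : 0 < α) (hMη : M * (η * lam) = 4) (hB : B = 2 ^ n * (α * η * lam))
    (hl1 : 1 ≤ l) (hαl : 400 * l ≤ α) (hl' : l' ≤ l) (hd : lam / 2 * p ≤ d)
    (hdn : d ≤ 2 * G ^ 2 / (lam * 2 ^ n)) :
    p / (2 * M * η) + 3 * η * (4 * (2 * G) ^ 2 * l / B) + 2 * (2 * G) ^ 2 * l' / (lam * B) / M ≤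
      2 * G ^ 2 / (lam * 2 ^ (n + 1)) := by
  have hMe : M = 4 / (η * lam) := by rw [eq_div_iff (by positivity)]; exact hMη
  have h2n : (0 : ℝ) < 2 ^ n := by positivity
  -- `W` is the target and the old error is at most `2 W`. As `2 M η = 8 / lam`, the distance term
  -- is at most `W / 2`; the two noise terms together are at most `50 / 400 * W`.
  set W := G ^ 2 / (lam * 2 ^ n) with hW
  have hW0 : 0 ≤ W := by positivity
  have h1 : p / (2 * M * η) ≤ W / 2 := by
    have e1 : p / (2 * M * η) = lam / 2 * p / 4 := by rw [hMe]; field_simp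
    have e2 : 2 * G ^ 2 / (lam * 2 ^ n) = 2 * W := by rw [hW]; ring
    rw [e1]
    linarith
  have h2 : 3 * η * (4 * (2 * G) ^ 2 * l / B) ≤ 48 / 400 * W := by
    have e1 : 3 * η * (4 * (2 * G) ^ 2 * l / B) = 48 * W * (l / α) := by
      rw [hB, hW]; field_simp; ring
    have e2 : l / α ≤ 1 / 400 := by rw [div_le_iff₀ hα]; linarith
    rw [e1]
    nlinarith
  have h3 : 2 * (2 * G) ^ 2 * l' / (lam * B) / M ≤ 2 / 400 * W := by
    have e1 : 2 * (2 * G) ^ 2 * l' / (lam * B) / M = 2 * W * (l' / α) := by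
      rw [hB, hW, hMe]; field_simp; ring
    have e2 : l' / α ≤ 1 / 400 := by rw [div_le_iff₀ hα]; linarith
    rw [e1]
    nlinarith
  have e : 2 * G ^ 2 / (lam * 2 ^ (n + 1)) = W := by rw [hW]; field_simp; ring
  rw [e]
  linarith

theorem measure_not_stateAfter_sub_le {F : E → ℝ} {gradF : E → E} {L lam G η α d : ℝ} {u : E}
    (hcl : IsClosed D) (hlam : 0 < lam) (hF : StrongConvexOn D lam F)
    (hgrad : ∀ w ∈ D, HasGradientWithinAt F (gradF w) D w)
    (hLip : ∀ w ∈ D, ∀ w' ∈ D, ‖gradF w - gradF w'‖ ≤ L * ‖w - w'‖)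
    (hu : u ∈ D) (hmin : IsMinOn F D u) (hη : 0 < η) (hηL : 3 * η ^ 2 * L ^ 2 ≤ 1)
    (hg : Measurable (Function.uncurry g))
    (hnoise : IsBoundedNoise P ξ (oracleNoise D g gradF) (2 * G)) (hG : 0 < G)
    (hgradG : ∀ w ∈ D, ‖gradF w‖ ≤ G) {M B₁ : ℕ} (hM : 0 < M) (hMη : M * (η * lam) = 4)
    (hα : 0 < α) (hB : (B₁ : ℝ) = α * η * lam) (hd : 0 < d) (hd1 : d ≤ 1)
    (hαd : 400 * Real.log (8 * M / d) ≤ α) {w₁ : E} (hw₁ : w₁ ∈ D) (n : ℕ) :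
    P {ω | ¬ F (stateAfter D η M B₁ w₁ (fun j w => g w (ξ j ω)) n).point - F u ≤
      2 * G ^ 2 / (lam * 2 ^ n)} ≤ n * ENNReal.ofReal d := by
  have hco := hF.1
  have hMr : (1 : ℝ) ≤ M := by exact_mod_cast hM
  have hB0 : 0 < B₁ := by
    have : (0 : ℝ) < B₁ := by rw [hB]; positivity
    exact_mod_cast this
  induction n with
  | zero =>
    have h1 := hF.sub_le_of_norm_gradient_le hlam hw₁ hu (hgrad _ hw₁) (hgradG _ hw₁)
    have h2 : G ^ 2 / (2 * lam) ≤ 2 * G ^ 2 / (lam * 2 ^ 0) := by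
      rw [pow_zero, mul_one, div_le_div_iff₀ (by positivity) hlam]
      nlinarith [mul_pos (pow_pos hG 2) hlam]
    have : {ω : Ω | ¬ F (stateAfter D η M B₁ w₁ (fun j w => g w (ξ j ω)) 0).point - F u ≤
      2 * G ^ 2 / (lam * 2 ^ 0)} = ∅ :=
      Set.eq_empty_of_forall_notMem fun ω hω => hω (h1.trans h2)
    rw [this]
    simp
  | succ n ih =>
    -- These levels split the failure probability evenly: `4 M exp (-l) = d / 2` and `exp (-l') = d
    -- / 2`.
    set l := Real.log (8 * M / d) with hl
    set l' := Real.log (2 / d) with hl'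
    have hl1 : 1 ≤ l := one_le_log_div hM hd hd1
    have hll : l' ≤ l := Real.log_le_log (by positivity) (by gcongr; linarith)
    have hBn : 0 < batchSize B₁ n := by rw [batchSize_eq]; positivity
    have key := measure_not_runEpoch_sub_le (η := η) (l' := l') hcl hlam hF hgrad hLip hη hηL hM hg
      hnoise (by positivity) (zero_le_one.trans hl1) hBn
      (s := fun ω => stateAfter D η M B₁ w₁ (fun j w => g w (ξ j ω)) n)
      (fun ω => stateAfter_calls D η M B₁ w₁ _ n)
      (measurable_stateAfter (continuous_euclideanProj ⟨u, hu⟩ hcl hco).measurable η hg M B₁ w₁ n)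
      (fun ω => stateAfter_mem hcl hco η hM B₁ hw₁ _ n) hu
    have hprob : 4 * M * Real.exp (-l) + Real.exp (-l') = d := by
      rw [Real.exp_neg, Real.exp_neg, hl, hl', Real.exp_log (by positivity),
        Real.exp_log (by positivity)]
      field_simp
      ring
    rw [hprob] at key
    refine (measure_mono (fun ω hω => ?_)).trans ((measure_union_le _ _).trans
      ((add_le_add ih key).trans_eq ?_))
    · by_contra hcon
      rw [Set.mem_union, not_or] at hcon
      obtain ⟨h1, h2⟩ := hcon
      have h1 := not_not.1 h1
      have h2 := not_not.1 h2
      refine hω (h2.trans ?_)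
      refine epoch_bound_le hη hlam hα hMη ?_ hl1 hαd hll
        (hF.sq_norm_sub_le_of_isMinOn (stateAfter_mem hcl hco η hM B₁ hw₁ _ n) hu (hgrad _ hu) hmin)
        h1
      rw [batchSize_eq, ← hB]
      push_cast
      ring
    · push_cast
      ring

theorem one_sub_le_measureReal_of_compl_le {A : Set Ω} {δ : ℝ} (hδ : 0 ≤ δ)
    (h : P Aᶜ ≤ ENNReal.ofReal δ) : 1 - δ ≤ P.real A := by
  have h1 : (1 : ENNReal) ≤ P A + P Aᶜ := by
    rw [← measure_univ (μ := P), ← Set.union_compl_self A]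
    exact measure_union_le _ _
  have h2 := ENNReal.toReal_mono (by finiteness) h1
  rw [ENNReal.toReal_add (by finiteness) (by finiteness), ENNReal.toReal_one] at h2
  have h3 := ENNReal.toReal_mono ENNReal.ofReal_ne_top h
  rw [ENNReal.toReal_ofReal hδ] at h3
  simp only [Measure.real]
  linarith

theorem one_sub_le_measureReal_runAlgorithm {F : E → ℝ} {gradF : E → E}
    {L lam G η α δ : ℝ} {u : E} (hcl : IsClosed D) (hlam : 0 < lam) (hF : StrongConvexOn D lam F)
    (hgrad : ∀ w ∈ D, HasGradientWithinAt F (gradF w) D w)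
    (hLip : ∀ w ∈ D, ∀ w' ∈ D, ‖gradF w - gradF w'‖ ≤ L * ‖w - w'‖)
    (hu : u ∈ D) (hmin : IsMinOn F D u) (hη : 0 < η) (hηL : 3 * η ^ 2 * L ^ 2 ≤ 1)
    (hg : Measurable (Function.uncurry g)) (hξ : ∀ i, Measurable (ξ i)) (hind : iIndepFun ξ P)
    (hmean : ∀ i, ∀ w ∈ D, ∫ ω, g w (ξ i ω) ∂P = gradF w)
    (hG : ∀ i, ∀ w ∈ D, ∀ᵐ ω ∂P, ‖g w (ξ i ω)‖ ≤ G) {M B₁ T : ℕ} (hM : 0 < M)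
    (hMη : M * (η * lam) = 4) (hα : 0 < α) (hB : (B₁ : ℝ) = α * η * lam) (hδ : 0 < δ)
    (hδ1 : δ < 1) (hk : 1 ≤ kDagger T α)
    (hαd : 400 * Real.log (8 * M / deltaTilde T δ α) ≤ α) {w₁ : E} (hw₁ : w₁ ∈ D) :
    1 - δ ≤ P.real {ω | F (runAlgorithm D η M B₁ T w₁ (fun j w => g w (ξ j ω))).point - F u ≤
      32 * α * G ^ 2 / (lam * T)} := by
  have hco := hF.1
  have hkr : (1 : ℝ) ≤ kDagger T α := by exact_mod_cast hk
  have hT0 : (0 : ℝ) < T := by linarith [eight_mul_le_of_one_le_kDagger hα hk]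
  have hMB : (M : ℝ) * B₁ = 4 * α := by rw [hB]; linear_combination α * hMη
  have hgradG : ∀ w ∈ D, ‖gradF w‖ ≤ G := fun w hw => by
    rw [← hmean 0 w hw]
    simpa using norm_integral_le_of_norm_le_const (hG 0 w hw)
  have hG0 : 0 ≤ G := (norm_nonneg _).trans (hgradG u hu)
  refine one_sub_le_measureReal_of_compl_le hδ.le ?_
  -- The concentration bounds need a positive noise bound `2 G`. For `G = 0` the gradient vanishes
  -- on `D` and every point of `D` is optimal.
  rcases hG0.eq_or_lt with h0 | hGpos
  · have : {ω | F (runAlgorithm D η M B₁ T w₁ (fun j w => g w (ξ j ω))).point - F u ≤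
      32 * α * G ^ 2 / (lam * T)}ᶜ = ∅ := by
      rw [Set.compl_empty_iff, Set.eq_univ_iff_forall]
      intro ω
      have hp := stateAfter_mem hcl hco η hM B₁ hw₁ (fun j w => g w (ξ j ω)) (numPasses M B₁ T)
      have h1 := hF.sub_le_of_norm_gradient_le hlam hp hu (hgrad _ hp) (hgradG _ hp)
      change F (stateAfter D η M B₁ w₁ _ (numPasses M B₁ T)).point - F u ≤ _
      rw [← h0]
      rw [← h0] at h1
      simpa using h1
    rw [this]
    simp
  · have hnoise := isBoundedNoise_oracleNoise ⟨u, hu⟩ hcl hco hLip hg hξ hind hmean hG hgradG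
    have key := measure_not_stateAfter_sub_le hcl hlam hF hgrad hLip hu hmin hη hηL hg hnoise hGpos
      hgradG hM hMη hα hB (deltaTilde_pos hδ hk) (deltaTilde_le_one hδ1 hk) hαd hw₁ (kDagger T α)
    have hd : (kDagger T α : ENNReal) * ENNReal.ofReal (deltaTilde T δ α) = ENNReal.ofReal δ := by
      rw [← ENNReal.ofReal_natCast, ← ENNReal.ofReal_mul (by positivity), deltaTilde,
        mul_div_cancel₀ _ (by positivity)]
    rw [hd] at key
    refine (measure_mono fun ω hω => ?_).trans key
    refine fun hle => hω ?_
    -- Maximality of `k†` gives `T < 16 α 2 ^ k†`, the source of the constant `32`.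
    have hfin : 2 * G ^ 2 / (lam * 2 ^ kDagger T α) ≤ 32 * α * G ^ 2 / (lam * T) := by
      have h1 := (le_kDagger_iff (T := T) hα (kDagger T α + 1)).not.1 (by omega)
      rw [← sub_le_iff_le_add, le_div_iff₀ (by positivity), not_le, pow_succ] at h1
      rw [div_le_div_iff₀ (by positivity) (by positivity)]
      have h2 : (T : ℝ) ≤ 16 * α * 2 ^ kDagger T α := by nlinarith
      calc 2 * G ^ 2 * (lam * T) ≤ 2 * G ^ 2 * (lam * (16 * α * 2 ^ kDagger T α)) := by gcongr
        _ = _ := by ring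
    change F (stateAfter D η M B₁ w₁ (fun j w => g w (ξ j ω)) (numPasses M B₁ T)).point - F u ≤ _
    rw [numPasses_eq_kDagger hα hMB]
    exact hle.trans hfin

end Convergence

/-! ### The main theorem. -/

theorem theorem2 (L lam : ℝ) (hL : 0 < L) (hlam : 0 < lam)
    (M : ℕ) (hM : (M : ℝ) = 4 / (stepSize L * lam)) :
    ∃ C : ℝ, 0 < C ∧
      -- orders of magnitude of the parameters
      (∀ (T : ℕ) (δ α : ℝ), 0 < δ → δ < 1 → 0 < α → 1 ≤ kDagger T α →
        alphaExpr L lam M T δ α ≤ α →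
          (kDagger T α : ℝ) ≤ C * Real.log T ∧
          8 * √6 * L / lam * (kDagger T α : ℝ) ≤ C * Real.log T ∧
          (shellCount L lam M T : ℝ) ≤ C * Real.log T ∧
          alphaExpr L lam M T δ α ≤ C * logFactor T δ ^ 4) ∧
      -- an admissible choice of this order, with an integral batch size, exists
      (∀ (T : ℕ) (δ : ℝ), 0 < δ → δ < 1 → 3 ≤ T → C * logFactor T δ ^ 4 ≤ T →
        ∃ (α : ℝ) (B₁ : ℕ), 0 < α ∧ (B₁ : ℝ) = α * stepSize L * lam ∧ 1 ≤ kDagger T α ∧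
          alphaExpr L lam M T δ α ≤ α ∧ α ≤ C * logFactor T δ ^ 4) ∧
      -- performance of the algorithm
      (∀ (E : Type*) [NormedAddCommGroup E] [InnerProductSpace ℝ E] [FiniteDimensional ℝ E]
        [CompleteSpace E] [MeasurableSpace E] [BorelSpace E]
        (Ω : Type*) [MeasurableSpace Ω] (P : Measure Ω) [IsProbabilityMeasure P]
        (S : Type*) [MeasurableSpace S]
        -- the problem: a smooth and strongly convex function on a closed convex domain
        (D : Set E) (F : E → ℝ) (gradF : E → E) (wStar : E),
        IsClosed D →
        StrongConvexOn D lam F →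
        (∀ w ∈ D, HasGradientWithinAt F (gradF w) D w) →
        (∀ w ∈ D, ∀ w' ∈ D, ‖gradF w - gradF w'‖ ≤ L * ‖w - w'‖) →
        wStar ∈ D → IsMinOn F D wStar →
        -- the oracle: call number `i` at `w` returns `g w (ξ i)`, with independent seeds `ξ i`
        ∀ (g : E → S → E) (ξ : ℕ → Ω → S) (G : ℝ),
        Measurable (Function.uncurry g) →
        (∀ i, Measurable (ξ i)) →
        iIndepFun ξ P →
        (∀ i, ∀ w ∈ D, ∫ ω, g w (ξ i ω) ∂P = gradF w) →
        (∀ i, ∀ w ∈ D, ∀ᵐ ω ∂P, ‖g w (ξ i ω)‖ ≤ G) →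
        -- the parameters
        ∀ (T : ℕ) (δ α : ℝ) (B₁ : ℕ), 0 < δ → δ < 1 → 0 < α → 1 ≤ kDagger T α →
        alphaExpr L lam M T δ α ≤ α →
        (B₁ : ℝ) = α * stepSize L * lam →
        ∀ w₁ ∈ D,
          (∀ ω, (runAlgorithm D (stepSize L) M B₁ T w₁ (fun j w => g w (ξ j ω))).calls ≤ T) ∧
          (∀ ω,
            ((runAlgorithm D (stepSize L) M B₁ T w₁ (fun j w => g w (ξ j ω))).projections : ℝ) =
              8 * √6 * L / lam * (⌊Real.logb 2 ((T : ℝ) / (8 * α) + 1)⌋₊ : ℝ)) ∧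
          1 - δ ≤ P.real {ω |
            F (runAlgorithm D (stepSize L) M B₁ T w₁ (fun j w => g w (ξ j ω))).point - F wStar ≤
              32 * α * G ^ 2 / (lam * T)} ∧
          (α ≤ C * logFactor T δ ^ 4 →
            1 - δ ≤ P.real {ω |
              F (runAlgorithm D (stepSize L) M B₁ T w₁ (fun j w => g w (ξ j ω))).point - F wStar ≤
                32 * C * G ^ 2 / lam * (logFactor T δ ^ 4 / T)})) := by
  have hη : 0 < stepSize L := by unfold stepSize; positivity
  have hM0 : 0 < M := by
    have : (0 : ℝ) < M := by rw [hM]; positivity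
    exact_mod_cast this
  have hMr : (0 : ℝ) < M := by exact_mod_cast hM0
  have hMη : (M : ℝ) * (stepSize L * lam) = 4 := by rw [hM]; field_simp
  have hM2 : 8 * √6 * L / lam = 2 * M := by rw [hM, stepSize]; field_simp; norm_num
  have hηL : 3 * stepSize L ^ 2 * L ^ 2 ≤ 1 := by
    have : 3 * stepSize L ^ 2 * L ^ 2 = 1 / 2 := by
      rw [stepSize, div_pow, mul_pow, Real.sq_sqrt (by norm_num)]; field_simp; norm_num
    rw [this]; norm_num
  obtain ⟨K, hK, hKb⟩ := exists_parameter_bound hM0 hMη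
  have hx₀ := log_log_three_pos
  set R := (1 + (M : ℝ) / 4) / Real.log (Real.log 3) ^ 4 with hR
  have hR0 : 0 < R := by positivity
  -- The summand `8 (K + R)` serves the existence of an admissible `α`; `4 M` covers the projection
  -- count `2 M k† ≤ 4 M log T`.
  refine ⟨8 * (K + R) + 4 * M, by positivity, ?_, ?_, ?_⟩
  · intro T δ α hδ hδ1 hα hk hadm
    have hl := one_le_log_div hM0 (deltaTilde_pos hδ hk) (deltaTilde_le_one hδ1 hk)
    have hα1 : 1 ≤ α := by linarith [alphaExpr_ge L lam hM0 hδ hδ1 hk]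
    -- Admissibility forces `α ≥ 1`, and `k† ≥ 1` forces `T ≥ 8 α`.
    have hT : 3 ≤ T := by
      have : (3 : ℝ) ≤ T := by linarith [eight_mul_le_of_one_le_kDagger hα hk]
      exact_mod_cast this
    obtain ⟨h1, h2, h3⟩ := hKb T δ α hT hδ hδ1 hα1 hk
    have hlT := one_le_log_of_three_le hT
    have h4 := kDagger_le hT hα1
    have hCK : K ≤ 8 * (K + R) + 4 * M := by linarith
    refine ⟨h1.trans (by gcongr), ?_, h2.trans (by gcongr), h3.trans (by gcongr)⟩
    rw [hM2]
    calc 2 * (M : ℝ) * kDagger T α ≤ 2 * M * (2 * Real.log T) := by gcongr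
      _ = 4 * M * Real.log T := by ring
      _ ≤ _ := by gcongr; linarith
  · intro T δ hδ hδ1 hT hCT
    exact exists_admissible hM0 hMη hK (fun T δ α hT hδ hδ1 hα hk => (hKb T δ α hT hδ hδ1 hα hk).2.2)
      (by linarith) hδ hδ1 hT hCT
  · intro E _ _ _ _ _ _ Ω _ P _ S _ D F gradF wStar hcl hF hgrad hLip hmem hmin g ξ G hg hξ hind
      hmean hG T δ α B₁ hδ hδ1 hα hk hadm hB w₁ hw₁
    -- Properness supplies the second countability used in the measurability arguments.
    have : ProperSpace E := FiniteDimensional.proper ℝ E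
    have hMB : (M : ℝ) * B₁ = 4 * α := by rw [hB]; linear_combination α * hMη
    have hmain := one_sub_le_measureReal_runAlgorithm hcl hlam hF hgrad hLip hmem hmin hη hηL hg hξ
      hind hmean hG hM0 hMη hα hB hδ hδ1 hk ((alphaExpr_ge L lam hM0 hδ hδ1 hk).trans hadm) hw₁
    have hpasses := numPasses_eq_kDagger (T := T) hα hMB
    refine ⟨fun ω => ?_, fun ω => ?_, hmain, fun hle => hmain.trans ?_⟩
    · rw [runAlgorithm, stateAfter_calls, hpasses, two_mul_sum_batchSize_le_iff hα hMB]
    · rw [runAlgorithm, stateAfter_projections, hpasses, hM2]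
      push_cast
      rfl
    · refine measureReal_mono fun ω hω => ?_
      rw [Set.mem_ofPred_eq] at hω ⊢
      refine hω.trans ?_
      calc 32 * α * G ^ 2 / (lam * T) ≤
          32 * ((8 * (K + R) + 4 * M) * logFactor T δ ^ 4) * G ^ 2 / (lam * T) := by gcongr
        _ = _ := by rw [← mul_div_assoc, div_mul_eq_mul_div, div_div]; ring
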